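/- Let $n \ge 4$ be an integer with $n \ne 6$. Then the maximum number of (not necessarily induced) subgraphs isomorphic to the $5$-cycle $C_5$ in a planar simple graph on $n$ vertices that contains no subgraph isomorphic to the $4$-cycle $C_4$ is exactly $n-4$. That is, every $C_4$-free planar graph on $n$ vertices contains at most $n-4$ copies of $C_5$, and some $C_4$-free planar graph on $n$ vertices contains exactly $n-4$ copies of $C_5$. -/

import Mathlib

/-- `A` is a (simple) arc in the Euclidean plane with endpoints `p` and `q`: the image of an
injective continuous map from `[0, 1]` to the plane that sends `0` to `p` and `1` to `q`. -/
def IsPlaneArc (p q : EuclideanSpace ℝ (Fin 2)) (A : Set (EuclideanSpace ℝ (Fin 2))) : Prop :=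
  ∃ γ : Path p q, Function.Injective γ ∧ Set.range γ = A

/-- An embedding of the graph `G` in the plane: distinct vertices are distinct points, each edge
is an arc joining its two ends, an edge contains no vertex other than its ends, and two distinct
edges have no point in common except common ends. -/
structure PlaneEmbedding {V : Type*} (G : SimpleGraph V) where
  /-- the point representing a vertex -/
  point : V → EuclideanSpace ℝ (Fin 2)
  /-- the arc representing an edge (values outside the edge set of `G` are irrelevant) -/
  arc : Sym2 V → Set (EuclideanSpace ℝ (Fin 2))
  point_injective : Function.Injective point
  isPlaneArc : ∀ u v : V, G.Adj u v → IsPlaneArc (point u) (point v) (arc s(u, v))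
  mem_of_point_mem_arc : ∀ e ∈ G.edgeSet, ∀ w : V, point w ∈ arc e → w ∈ e
  arc_inter_arc : ∀ e ∈ G.edgeSet, ∀ f ∈ G.edgeSet, e ≠ f →
    ∀ x ∈ arc e ∩ arc f, ∃ w : V, w ∈ e ∧ w ∈ f ∧ x = point w

/-- A graph is planar if it has an embedding in the plane. -/
def IsPlanarGraph {V : Type*} (G : SimpleGraph V) : Prop :=
  Nonempty (PlaneEmbedding G)

/-- The numbers `k` for which some planar graph on `n` vertices that contains no subgraph
isomorphic to `F` has exactly `k` subgraphs isomorphic to `H`. The greatest element of this set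
is the planar generalized Turán number of `n`, `H`, `F`. -/
def planarCopyCounts {U W : Type*} (n : ℕ) (H : SimpleGraph U) (F : SimpleGraph W) : Set ℕ :=
  {k | ∃ G : SimpleGraph (Fin n), IsPlanarGraph G ∧ F.Free G ∧ G.copyCount H = k}

/-! The upper bound is proved for graphs all of whose subgraphs have an abstract dual over the
two-element field (`SimpleGraph.card_pentagons_le`); topology enters only to supply the duals.
Without `4`-cycles every pentagon is induced, so pentagons can be counted by their vertex sets.
Suppose that deleting a vertex disconnects two of its neighbours, or that deleting a pentagon
disconnects two other non-isolated vertices. Then the graph splits along the deleted set, no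
pentagon crosses the split (`pentagon_subset_or`), and induction applies. Along a pentagon the
bounds add up to (n₁ - 4) + (n₂ - 4) - 1 = n - 4, because n₁ + n₂ = n + 5 and the separating
pentagon is counted twice. If there is no such split, every pentagon bounds a face
(`IsDual.exists_faceChain_eq`, in the spirit of Tutte's theorem on nonseparating induced cycles).
Euler's inequality, with p faces of length at least 5 and the others of length at least 3, then
gives 3p ≤ 2n - 4, which suffices.

For the duals, each arc of a plane drawing is cut into thirds. The stars formed by the end thirds at
a vertex, and the middle thirds, are compact connected sets; on a fine enough square grid they
thicken to connected sets of grid points without new intersections (`PlaneEmbedding.hasDual`). So a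
planar graph is a minor of the grid. The grid has an explicit dual, found by counting edges above a
cell (`grid_exists_coboundary`), and duality passes to minors (`exists_isDual_of_minor`). The Jordan
curve theorem is not needed.

The lower bound uses finite pieces of a planar ladder without `4`-cycles: two poles with a common
neighbour, and paths of length three between the poles. Each new path costs two vertices and creates
two pentagons (`HasManyPentagons.add_two`), starting from 5 or 8 vertices. -/

/-! ### Chains modulo two. -/

open Relation in
/-- If `x` and `y` are connected inside `B`, some finite even-sized set of edges inside `B` has
odd degree exactly at `x` and `y`. -/
lemma exists_join {W : Type*} [DecidableEq W] {nb : W → Finset W}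
    (hnb : ∀ p q, q ∈ nb p → p ∈ nb q) {B : Set W} {x y : W}
    (h : ReflTransGen (fun p q => p ∈ B ∧ q ∈ B ∧ q ∈ nb p) x y) :
    ∃ T : W → W → ZMod 2, (∀ p q, T p q = T q p) ∧
      (∀ p q, T p q ≠ 0 → p ∈ B ∧ q ∈ B ∧ q ∈ nb p) ∧
      {p | ∃ q, T p q ≠ 0}.Finite ∧
      ∀ p, ∑ q ∈ nb p, T p q = (if p = x then 1 else 0) + (if p = y then 1 else 0) := by
  induction h with
  | refl =>
    refine ⟨fun _ _ => 0, by simp, by simp, by simp, fun p => ?_⟩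
    simp only [Finset.sum_const_zero]
    exact (CharTwo.add_self_eq_zero _).symm
  | @tail y z _ hyz ih =>
    obtain ⟨T, hs, hB, hf, hd⟩ := ih
    obtain ⟨hy, hz, hn⟩ := hyz
    -- Adding the edge `yz` modulo two moves the odd end from `y` to `z`.
    refine ⟨fun p q => T p q + ((if p = y ∧ q = z then 1 else 0) +
      (if p = z ∧ q = y then 1 else 0)), fun p q => ?_, fun p q hpq => ?_, ?_, fun p => ?_⟩
    · beta_reduce
      rw [hs p q, add_comm (if p = y ∧ q = z then (1 : ZMod 2) else 0)]
      simp only [and_comm]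
    · by_cases h0 : T p q = 0
      · by_cases h1 : p = y ∧ q = z
        · obtain ⟨rfl, rfl⟩ := h1; exact ⟨hy, hz, hn⟩
        · by_cases h2 : p = z ∧ q = y
          · obtain ⟨rfl, rfl⟩ := h2; exact ⟨hz, hy, hnb _ _ hn⟩
          · simp [h0, h1, h2] at hpq
      · exact hB p q h0
    · refine (hf.union (Set.toFinite {y, z})).subset ?_
      rintro p ⟨q, hpq⟩
      by_cases h0 : T p q = 0
      · right
        by_cases h1 : p = y
        · simp [h1]
        · by_cases h2 : p = z
          · simp [h2]
          · simp [h0, h1, h2] at hpq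
      · exact Or.inl ⟨q, h0⟩
    · have e1 : ∑ q ∈ nb p, (if p = y ∧ q = z then (1 : ZMod 2) else 0) =
          if p = y then 1 else 0 := by
        by_cases h : p = y
        · subst h; simp [hn]
        · simp [h]
      have e2 : ∑ q ∈ nb p, (if p = z ∧ q = y then (1 : ZMod 2) else 0) =
          if p = z then 1 else 0 := by
        by_cases h : p = z
        · subst h; simp [hnb _ _ hn]
        · simp [h]
      rw [Finset.sum_add_distrib, Finset.sum_add_distrib, hd, e1, e2]
      have := CharTwo.add_self_eq_zero (if p = y then (1 : ZMod 2) else 0)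
      linear_combination this

/-- Every pair of distinct points contributes two equal terms. This serves as the handshake lemma
and cancels the edges inside a branch set. -/
lemma sum_sum_eq_zero_of_symm {W : Type*} (B : Finset W) (z : W → W → ZMod 2)
    (hz : ∀ p q, z p q = z q p) (h0 : ∀ p, z p p = 0) : ∑ p ∈ B, ∑ q ∈ B, z p q = 0 := by
  classical
  rw [← Finset.sum_product']
  refine Finset.sum_involution (fun a _ => (a.2, a.1)) ?_ ?_ ?_ ?_
  · rintro ⟨p, q⟩ _
    simp only
    rw [hz q p]; exact CharTwo.add_self_eq_zero _
  · rintro ⟨p, q⟩ _ hne heq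
    simp only [Prod.mk.injEq] at heq
    obtain ⟨rfl, _⟩ := heq
    exact hne (h0 _)
  · rintro ⟨p, q⟩ h
    simp only [Finset.mem_product] at h ⊢
    exact ⟨h.2, h.1⟩
  · rintro ⟨p, q⟩ _; rfl

/-! ### Abstract duals, pentagons and separations. -/

namespace SimpleGraph

variable {V : Type*}

/-- Whitney's abstract duality over the two-element field: `l u v` is the face to the left of the
dart `(u, v)`, and the even edge sets are the coboundaries of the functions on the faces. -/
def IsDual [Fintype V] (G : SimpleGraph V) {F : Type*} (l : V → V → F) : Prop :=
  ∀ z : V → V → ZMod 2, (∀ u v, z u v = z v u) → (∀ u v, ¬ G.Adj u v → z u v = 0) →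
    ((∀ u, ∑ v, z u v = 0) ↔
      ∃ w : F → ZMod 2, ∀ u v, G.Adj u v → z u v = w (l u v) + w (l v u))

/-- The graph has an abstract dual. -/
def HasDual [Fintype V] (G : SimpleGraph V) : Prop :=
  ∃ (F : Type) (_ : Fintype F) (l : V → V → F), G.IsDual l

/-- Only the partition of the darts by their left faces matters, so the faces may be replaced by the
classes of a quotient of `V × V`. This makes the dual finite, as Euler's inequality requires, and
puts it in the right universe. -/
lemma IsDual.hasDual {V : Type} [Fintype V] {G : SimpleGraph V} {F : Type*}
    {l : V → V → F} (h : G.IsDual l) : G.HasDual := by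
  classical
  let s : Setoid (V × V) := Setoid.ker (fun p => l p.1 p.2)
  refine ⟨Quotient s, Fintype.ofFinite _, fun u v => Quotient.mk s (u, v), fun z hz hz0 => ?_⟩
  rw [h z hz hz0]
  constructor
  · rintro ⟨w, hw⟩
    exact ⟨fun q => Quotient.lift (fun p : V × V => w (l p.1 p.2))
      (fun a b hab => congrArg w hab) q, fun u v huv => hw u v huv⟩
  · rintro ⟨w, hw⟩
    refine ⟨fun f => if hf : ∃ p : V × V, l p.1 p.2 = f then w (Quotient.mk s hf.choose) else 0,
      fun u v huv => ?_⟩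
    have key : ∀ u v, (if hf : ∃ p : V × V, l p.1 p.2 = l u v then
        w (Quotient.mk s hf.choose) else 0) = w (Quotient.mk s (u, v)) := by
      intro u v
      have hf : ∃ p : V × V, l p.1 p.2 = l u v := ⟨(u, v), rfl⟩
      rw [dif_pos hf]
      exact congrArg w (Quotient.sound hf.choose_spec)
    simp only [key]
    exact hw u v huv

/-- `f` runs through the vertices of a `5`-cycle of `G` in order. -/
def IsPentagon (G : SimpleGraph V) (f : Fin 5 → V) : Prop :=
  Function.Injective f ∧ ∀ i, G.Adj (f i) (f (i + 1))

/-- There is no `4`-cycle. -/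
def NoSquare (G : SimpleGraph V) : Prop :=
  ∀ a b c d, a ≠ c → b ≠ d → G.Adj a b → G.Adj b c → G.Adj c d → ¬ G.Adj d a

lemma NoSquare.mono {G H : SimpleGraph V} (h : G.NoSquare) (hle : H ≤ G) : H.NoSquare :=
  fun a b c d hac hbd h1 h2 h3 h4 => h a b c d hac hbd (hle h1) (hle h2) (hle h3) (hle h4)

open Classical in
/-- The vertex sets of the `5`-cycles. -/
noncomputable def pentagons [Fintype V] (G : SimpleGraph V) : Finset (Finset V) :=
  Finset.univ.filter (fun U => ∃ f, G.IsPentagon f ∧ Finset.univ.image f = U)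

open Classical in
lemma mem_pentagons [Fintype V] {G : SimpleGraph V} {U : Finset V} :
    U ∈ G.pentagons ↔ ∃ f, G.IsPentagon f ∧ Finset.univ.image f = U := by
  simp [pentagons]

lemma IsPentagon.card {G : SimpleGraph V} [DecidableEq V] {f : Fin 5 → V} (h : G.IsPentagon f) :
    (Finset.univ.image f).card = 5 := by
  rw [Finset.card_image_of_injective _ h.1]; simp

lemma IsPentagon.rotate {G : SimpleGraph V} {f : Fin 5 → V} (h : G.IsPentagon f) (k : Fin 5) :
    G.IsPentagon (fun i => f (i + k)) :=
  ⟨h.1.comp (add_left_injective k), fun i => by beta_reduce; rw [add_right_comm]; exact h.2 _⟩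

lemma IsPentagon.adj_sub {G : SimpleGraph V} {f : Fin 5 → V} (h : G.IsPentagon f) (i : Fin 5) :
    G.Adj (f i) (f (i - 1)) := by
  have := h.2 (i - 1)
  rw [sub_add_cancel] at this
  exact this.symm

lemma IsPentagon.reflect {G : SimpleGraph V} {f : Fin 5 → V} (h : G.IsPentagon f) :
    G.IsPentagon (fun i => f (-i)) :=
  ⟨h.1.comp neg_injective, fun i => by beta_reduce; rw [neg_add, ← sub_eq_add_neg]; exact h.adj_sub _⟩

/-- A chord of a `5`-cycle cuts off a `4`-cycle, so pentagons are induced. -/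
lemma IsPentagon.adj_iff {G : SimpleGraph V} (h4 : G.NoSquare) {f : Fin 5 → V}
    (h : G.IsPentagon f) (i j : Fin 5) : G.Adj (f i) (f j) ↔ j = i + 1 ∨ j = i - 1 := by
  constructor
  · intro hij
    have h1 := h.2 i; have h2 := h.2 (i + 1); have h3 := h.2 (i + 2); have h5 := h.2 (i + 3)
    have h6 := h.2 (i + 4)
    have hne : ∀ a b, a ≠ b → f a ≠ f b := fun a b hab h' => hab (h.1 h')
    have e1 : i + 1 + 1 = i + 2 := by rw [add_assoc]; rfl
    have e2 : i + 2 + 1 = i + 3 := by rw [add_assoc]; rfl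
    have e3 : i + 3 + 1 = i + 4 := by rw [add_assoc]; rfl
    have e4 : i + 4 + 1 = i := by rw [add_assoc]; simp
    rw [e1] at h2; rw [e2] at h3; rw [e3] at h5; rw [e4] at h6
    have hj : j = i + (j - i) := by abel
    generalize j - i = k at hj
    subst hj
    have d1 : i ≠ i + 3 := by simp
    have d2 : i + 2 ≠ i + 4 := by simp
    have d3 : i ≠ i + 2 := by simp
    have d4 : i + 1 ≠ i + 3 := by simp
    fin_cases k
    · simp at hij
    · left; rfl
    · exact (h4 _ _ _ _ (hne _ _ d1) (hne _ _ d2) hij h3 h5 h6).elim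
    · exact (h4 _ _ _ _ (hne _ _ d3) (hne _ _ d4) h1 h2 h3 hij.symm).elim
    · right; exact (by decide : ∀ i : Fin 5, i + 4 = i - 1) i
  · rintro (rfl | rfl)
    · exact h.2 i
    · exact h.adj_sub i

lemma IsPentagon.adj_or_exists {G : SimpleGraph V} {f : Fin 5 → V}
    (h : G.IsPentagon f) (i j : Fin 5) (hij : i ≠ j) : G.Adj (f i) (f j) ∨
      ∃ k, G.Adj (f i) (f k) ∧ G.Adj (f k) (f j) := by
  have hj : j = i + (j - i) := by abel
  generalize j - i = k at hj
  subst hj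
  fin_cases k
  · simp at hij
  · left; exact h.2 i
  · right; refine ⟨i + 1, h.2 i, ?_⟩
    have := h.2 (i + 1); rw [add_assoc] at this; exact this
  · right
    refine ⟨i - 1, h.adj_sub i, ?_⟩
    have := h.adj_sub (i - 1); convert this using 2
    exact (by decide : ∀ i : Fin 5, i + 3 = i - 1 - 1) i
  · left; have := h.adj_sub i; convert this using 2
    exact (by decide : ∀ i : Fin 5, i + 4 = i - 1) i

open Classical in
/-- Two vertices of a pentagon with a common neighbour off the pentagon are adjacent. -/
lemma IsPentagon.adj_of_common {G : SimpleGraph V} (h4 : G.NoSquare) {f : Fin 5 → V}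
    (h : G.IsPentagon f) {x y z : V} (hx : x ∈ Finset.univ.image f)
    (hy : y ∈ Finset.univ.image f) (hz : z ∉ Finset.univ.image f) (hxy : x ≠ y)
    (hxz : G.Adj x z) (hzy : G.Adj z y) : G.Adj x y := by
  simp only [Finset.mem_image, Finset.mem_univ, true_and, not_exists] at hx hy hz
  obtain ⟨i, rfl⟩ := hx
  obtain ⟨j, rfl⟩ := hy
  rcases h.adj_or_exists i j (fun h' => hxy (h' ▸ rfl)) with h1 | ⟨k, hk1, hk2⟩
  · exact h1
  · exact (h4 _ _ _ _ hxy (fun h' => hz k h'.symm) hxz hzy hk2.symm hk1.symm).elim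

open Classical in
/-- No pentagon of a graph without `4`-cycles crosses a separation of order at most one or along a
pentagon. -/
lemma pentagon_subset_or [Fintype V] {G : SimpleGraph V} (h4 : G.NoSquare) {S₁ S₂ : Finset V}
    (hsep : ∀ u v, G.Adj u v → (u ∈ S₁ ∧ v ∈ S₁) ∨ (u ∈ S₂ ∧ v ∈ S₂))
    (hT : (S₁ ∩ S₂).card ≤ 1 ∨ ∃ g, G.IsPentagon g ∧ S₁ ∩ S₂ = Finset.univ.image g)
    {f : Fin 5 → V} (hf : G.IsPentagon f) :
    (∀ i, f i ∈ S₁) ∨ (∀ i, f i ∈ S₂) := by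
  have hcov : ∀ i, f i ∈ S₁ ∨ f i ∈ S₂ := fun i => by
    rcases hsep _ _ (hf.2 i) with h | h
    · exact Or.inl h.1
    · exact Or.inr h.1
  -- With `f 0` and `f 2` strictly on opposite sides, `f 1` and one of `f 3`, `f 4` lie on the
  -- separator. If the separator is a pentagon, these two vertices have a common neighbour off it,
  -- hence are adjacent; this is a chord of `f` and closes a `4`-cycle.
  have core : ∀ f : Fin 5 → V, G.IsPentagon f → f 0 ∉ S₂ → f 2 ∉ S₁ → False := by
    intro f hf h0 h2
    have a01 := hf.2 0; have a12 := hf.2 1; have a23 := hf.2 2; have a34 := hf.2 3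
    have a40 := hf.2 4
    simp only [show (0 : Fin 5) + 1 = 1 from rfl, show (1 : Fin 5) + 1 = 2 from rfl,
      show (2 : Fin 5) + 1 = 3 from rfl, show (3 : Fin 5) + 1 = 4 from rfl,
      show (4 : Fin 5) + 1 = 0 from rfl] at a01 a12 a23 a34 a40
    have ne : ∀ a b, a ≠ b → f a ≠ f b := fun a b hab h' => hab (hf.1 h')
    have m1 : f 1 ∈ S₁ ∩ S₂ := by
      have := hsep _ _ a01; have := hsep _ _ a12
      simp only [Finset.mem_inter]; tauto
    have m3 : f 3 ∈ S₂ := by have := hsep _ _ a23; tauto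
    have m4 : f 4 ∈ S₁ := by have := hsep _ _ a40; tauto
    have m34 : f 3 ∈ S₁ ∩ S₂ ∨ f 4 ∈ S₁ ∩ S₂ := by
      have := hsep _ _ a34
      simp only [Finset.mem_inter]; tauto
    have n0 : f 0 ∉ S₁ ∩ S₂ := by simp [h0]
    have n2 : f 2 ∉ S₁ ∩ S₂ := by simp [h2]
    rcases hT with hT | ⟨g, hg, hT⟩
    · rcases m34 with m | m
      · exact ne 1 3 (by decide) (Finset.card_le_one.1 hT _ m1 _ m)
      · exact ne 1 4 (by decide) (Finset.card_le_one.1 hT _ m1 _ m)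
    · rw [hT] at m1 m34 n0 n2
      by_cases m : f 3 ∈ Finset.univ.image g
      · have := hg.adj_of_common h4 m1 m n2 (ne 1 3 (by decide)) a12 a23
        exact h4 _ _ _ _ (ne 0 3 (by decide)) (ne 1 4 (by decide)) a01 this a34 a40
      · have m := m34.resolve_left m
        have := hg.adj_of_common h4 m1 m n0 (ne 1 4 (by decide)) a01.symm a40.symm
        exact h4 _ _ _ _ (ne 1 3 (by decide)) (ne 2 4 (by decide)) a12 a23 a34 this.symm
  by_contra! hcon
  obtain ⟨⟨j, hj⟩, i, hi⟩ := hcon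
  have hij : ¬ G.Adj (f i) (f j) := fun h => by have := hsep _ _ h; tauto
  have hne : i ≠ j := by rintro rfl; have := hcov i; tauto
  have hk : j = i + (j - i) := by abel
  generalize j - i = k at hk
  subst hk
  -- Non-adjacent vertices of a `5`-cycle are at distance two, so a rotation and possibly a
  -- reflection lead to `core`.
  fin_cases k
  · simp at hne
  · exact hij (hf.2 i)
  · refine core _ (hf.rotate i) (by simpa using hi) ?_
    simpa [add_comm] using hj
  · refine core _ ((hf.rotate i).reflect) (by simpa using hi) ?_
    have e : (-2 : Fin 5) + i = i + 3  :=
      (by decide : ∀ i : Fin 5, (-2 : Fin 5) + i = i + 3) i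
    simpa [e] using hj
  · apply hij
    have := hf.adj_sub i
    convert this using 2
    exact (by decide : ∀ i : Fin 5, i + 4 = i - 1) i

/-- The edges with both ends in `S`. -/
def restrict (G : SimpleGraph V) (S : Finset V) : SimpleGraph V where
  Adj u v := G.Adj u v ∧ u ∈ S ∧ v ∈ S
  symm := ⟨fun _ _ h => ⟨h.1.symm, h.2.2, h.2.1⟩⟩
  loopless := ⟨fun _ h => h.1.ne rfl⟩

lemma restrict_le (G : SimpleGraph V) (S : Finset V) : G.restrict S ≤ G := fun _ _ h => h.1

lemma mem_pentagons_restrict [Fintype V] {G : SimpleGraph V} {S U : Finset V} :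
    U ∈ (G.restrict S).pentagons ↔ U ∈ G.pentagons ∧ U ⊆ S := by
  classical
  rw [mem_pentagons, mem_pentagons]
  constructor
  · rintro ⟨f, hf, rfl⟩
    refine ⟨⟨f, ⟨hf.1, fun i => (hf.2 i).1⟩, by congr⟩, ?_⟩
    intro x hx
    simp only [Finset.mem_image, Finset.mem_univ, true_and] at hx
    obtain ⟨i, rfl⟩ := hx
    exact (hf.2 i).2.1
  · rintro ⟨⟨f, hf, rfl⟩, hS⟩
    have : ∀ i, f i ∈ S := fun i => hS (by simp)
    exact ⟨f, ⟨hf.1, fun i => ⟨hf.2 i, this _, this _⟩⟩, by congr⟩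

lemma card_of_mem_pentagons [Fintype V] {G : SimpleGraph V} {U : Finset V} (h : U ∈ G.pentagons) :
    U.card = 5 := by
  classical
  obtain ⟨f, hf, rfl⟩ := mem_pentagons.1 h
  convert hf.card

/-- Pentagon bounds on the two sides of a separation combine to a bound for the graph. -/
lemma card_pentagons_le_of_separation [Fintype V] [DecidableEq V] {G : SimpleGraph V}
    (h4 : G.NoSquare) {S S₁ S₂ : Finset V} (hS : S₁ ∪ S₂ = S)
    (hsep : ∀ u v, G.Adj u v → (u ∈ S₁ ∧ v ∈ S₁) ∨ (u ∈ S₂ ∧ v ∈ S₂))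
    (hT : (S₁ ∩ S₂).card ≤ 1 ∨ S₁ ∩ S₂ ∈ G.pentagons)
    (h₁ : (G.restrict S₁).pentagons.card ≤ S₁.card - 4)
    (h₂ : (G.restrict S₂).pentagons.card ≤ S₂.card - 4) :
    G.pentagons.card ≤ S.card - 4 := by
  have hsub : G.pentagons ⊆ (G.restrict S₁).pentagons ∪ (G.restrict S₂).pentagons := by
    intro U hU
    rw [Finset.mem_union, mem_pentagons_restrict, mem_pentagons_restrict]
    obtain ⟨f, hf, rfl⟩ := mem_pentagons.1 hU
    have hT' : (S₁ ∩ S₂).card ≤ 1 ∨ ∃ g, G.IsPentagon g ∧ S₁ ∩ S₂ = Finset.univ.image g := by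
      refine hT.imp_right fun h => ?_
      obtain ⟨g, hg, h⟩ := mem_pentagons.1 h
      exact ⟨g, hg, by convert h.symm⟩
    have := pentagon_subset_or h4 hsep (by convert hT') hf
    refine this.imp (fun h => ⟨hU, ?_⟩) (fun h => ⟨hU, ?_⟩)
    all_goals
      intro x hx
      simp only [Finset.mem_image, Finset.mem_univ, true_and] at hx
      obtain ⟨i, rfl⟩ := hx
      exact h i
  have c1 := Finset.card_le_card hsub
  have c2 := Finset.card_union_add_card_inter (G.restrict S₁).pentagons (G.restrict S₂).pentagons
  have c3 := Finset.card_union_add_card_inter S₁ S₂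
  rw [hS] at c3
  have c4 : S₁.card ≤ S.card := Finset.card_le_card (hS ▸ Finset.subset_union_left)
  have c5 : S₂.card ≤ S.card := Finset.card_le_card (hS ▸ Finset.subset_union_right)
  -- The orders of the sides add up to at most n + 1 in the first case. In the second they add up to
  -- n + 5, and the separating pentagon is counted on both sides, which saves the one that is
  -- missing.
  rcases hT with hT | hT
  · omega
  · have c6 : S₁ ∩ S₂ ∈ (G.restrict S₁).pentagons ∩ (G.restrict S₂).pentagons := by
      simp [Finset.mem_inter, mem_pentagons_restrict, hT]
    have c7 := Finset.card_pos.2 ⟨_, c6⟩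
    have c8 := card_of_mem_pentagons hT
    omega

end SimpleGraph

/-! ### Non-separating pentagons bound faces. -/

open Relation

namespace SimpleGraph

open Classical in
/-- The edges of `G` inside `U`, as a chain. -/
noncomputable def insideChain {V : Type*} (G : SimpleGraph V) (U : Finset V) (u v : V) : ZMod 2 :=
  if G.Adj u v ∧ u ∈ U ∧ v ∈ U then 1 else 0

open Classical in
/-- The coboundary of a single face, as a chain. -/
noncomputable def faceChain {V : Type*} (G : SimpleGraph V) {F : Type*} (l : V → V → F) (f : F) (u v : V) :
    ZMod 2 :=
  if G.Adj u v then (if l u v = f then 1 else 0) + (if l v u = f then 1 else 0) else 0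

lemma insideChain_comm {V : Type*} (G : SimpleGraph V) (U : Finset V) (u v : V) :
    G.insideChain U u v = G.insideChain U v u := by
  classical
  unfold insideChain
  refine if_congr ?_ rfl rfl
  rw [G.adj_comm, and_comm (a := u ∈ U)]

lemma faceChain_comm {V : Type*} (G : SimpleGraph V) {F : Type*} (l : V → V → F) (f : F) (u v : V) :
    G.faceChain l f u v = G.faceChain l f v u := by
  classical
  unfold faceChain
  exact if_congr (G.adj_comm u v) (add_comm _ _) rfl

lemma faceChain_of_not_adj {V : Type*} (G : SimpleGraph V) {F : Type*} (l : V → V → F) (f : F) {u v : V}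
    (h : ¬ G.Adj u v) : G.faceChain l f u v = 0 := by
  simp [faceChain, h]

set_option linter.unusedSectionVars false

variable {V : Type*} [Fintype V] [DecidableEq V]

lemma IsDual.sum_faceChain {G : SimpleGraph V} {F : Type*} {l : V → V → F} (hl : G.IsDual l)
    (f : F) (u : V) : ∑ v, G.faceChain l f u v = 0 := by
  classical
  refine (hl _ (faceChain_comm G l f) (fun _ _ => faceChain_of_not_adj G l f)).2
    ⟨fun f' => if f' = f then 1 else 0, fun u v huv => ?_⟩ u
  simp [faceChain, huv]

/-- As the pentagon is induced, a chain supported inside it sees only the two cycle edges at each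
vertex. -/
lemma IsPentagon.sum_image {G : SimpleGraph V} (h4 : G.NoSquare) {g : Fin 5 → V}
    (hg : G.IsPentagon g) (z : V → V → ZMod 2)
    (hz : ∀ u v, G.insideChain (Finset.univ.image g) u v = 0 → z u v = 0) (i : Fin 5) :
    ∑ v, z (g i) v = z (g i) (g (i + 1)) + z (g i) (g (i - 1)) := by
  have hne : g (i + 1) ≠ g (i - 1) := fun h =>
    (by decide : ∀ i : Fin 5, i + 1 ≠ i - 1) i (hg.1 h)
  rw [← Finset.sum_pair hne]
  symm
  apply Finset.sum_subset (Finset.subset_univ _)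
  intro v _ hv
  apply hz
  rw [insideChain, if_neg]
  rintro ⟨hadj, -, hmem⟩
  simp only [Finset.mem_image, Finset.mem_univ, true_and] at hmem
  obtain ⟨j, rfl⟩ := hmem
  rw [hg.adj_iff h4] at hadj
  rcases hadj with rfl | rfl <;> simp at hv

lemma IsPentagon.insideChain_succ {G : SimpleGraph V} {g : Fin 5 → V}
    (hg : G.IsPentagon g) (i : Fin 5) :
    G.insideChain (Finset.univ.image g) (g i) (g (i + 1)) = 1 := by
  simp [insideChain, hg.2 i]

lemma IsPentagon.insideChain_pred {G : SimpleGraph V} {g : Fin 5 → V}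
    (hg : G.IsPentagon g) (i : Fin 5) :
    G.insideChain (Finset.univ.image g) (g i) (g (i - 1)) = 1 := by
  simp [insideChain, hg.adj_sub i]

lemma IsPentagon.sum_insideChain {G : SimpleGraph V} (h4 : G.NoSquare) {g : Fin 5 → V}
    (hg : G.IsPentagon g) (u : V) : ∑ v, G.insideChain (Finset.univ.image g) u v = 0 := by
  by_cases hu : u ∈ Finset.univ.image g
  · simp only [Finset.mem_image, Finset.mem_univ, true_and] at hu
    obtain ⟨i, rfl⟩ := hu
    rw [hg.sum_image h4 _ (fun _ _ h => h), hg.insideChain_succ, hg.insideChain_pred]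
    exact CharTwo.add_self_eq_zero _
  · exact Finset.sum_eq_zero fun v _ => by rw [insideChain, if_neg (fun h => hu h.2.1)]

/-- A nonempty even set of edges of a pentagon is the whole pentagon. -/
lemma IsPentagon.eq_insideChain {G : SimpleGraph V} (h4 : G.NoSquare) {g : Fin 5 → V}
    (hg : G.IsPentagon g) {z : V → V → ZMod 2} (hsym : ∀ u v, z u v = z v u)
    (heven : ∀ u, ∑ v, z u v = 0)
    (hz : ∀ u v, G.insideChain (Finset.univ.image g) u v = 0 → z u v = 0)
    {i₀ : Fin 5} (hi₀ : z (g i₀) (g (i₀ + 1)) ≠ 0) :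
    z = G.insideChain (Finset.univ.image g) := by
  have two : ∀ a : ZMod 2, a ≠ 0 → a = 1 := by decide
  -- Evenness at a vertex makes `z` agree on the two cycle edges there.
  have step : ∀ i, z (g i) (g (i + 1)) = z (g (i + 1)) (g (i + 1 + 1)) := by
    intro i
    have h := heven (g (i + 1))
    rw [hg.sum_image h4 z hz] at h
    rw [add_sub_cancel_right, hsym (g (i + 1)) (g i)] at h
    exact (CharTwo.add_eq_zero.1 h).symm
  have s0 := two _ hi₀
  have s1 := (step _).symm.trans s0
  have s2 := (step _).symm.trans s1
  have s3 := (step _).symm.trans s2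
  have s4 := (step _).symm.trans s3
  have all : ∀ i, z (g i) (g (i + 1)) = 1 := by
    intro i
    rcases (by decide : ∀ i j : Fin 5, i = j ∨ i = j + 1 ∨ i = j + 1 + 1 ∨ i = j + 1 + 1 + 1 ∨
      i = j + 1 + 1 + 1 + 1) i i₀ with rfl | rfl | rfl | rfl | rfl <;> assumption
  ext u v
  by_cases h : G.insideChain (Finset.univ.image g) u v = 0
  · rw [h, hz u v h]
  · rw [two _ h]
    simp only [insideChain, ite_eq_right_iff, one_ne_zero, imp_false, not_not] at h
    obtain ⟨hadj, hu, hv⟩ := h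
    simp only [Finset.mem_image, Finset.mem_univ, true_and] at hu hv
    obtain ⟨i, rfl⟩ := hu
    obtain ⟨j, rfl⟩ := hv
    rw [hg.adj_iff h4] at hadj
    rcases hadj with rfl | rfl
    · exact all i
    · rw [hsym]
      have := all (i - 1)
      rwa [sub_add_cancel] at this

/-- A pentagon with connected complement bounds a face of the dual, if deleting any vertex leaves
the neighbours of that vertex connected. -/
lemma IsDual.exists_faceChain_eq {G : SimpleGraph V} (h4 : G.NoSquare) {F : Type*}
    {l : V → V → F} (hl : G.IsDual l) {g : Fin 5 → V} (hg : G.IsPentagon g)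
    (h1 : ∀ v x y, G.Adj v x → G.Adj v y →
      ReflTransGen (fun p q => p ≠ v ∧ q ≠ v ∧ G.Adj p q) x y)
    (h2 : ∀ x y x' y', G.Adj x x' → G.Adj y y' → x ∉ Finset.univ.image g →
      y ∉ Finset.univ.image g → ReflTransGen
        (fun p q => p ∉ Finset.univ.image g ∧ q ∉ Finset.univ.image g ∧ G.Adj p q) x y) :
    ∃ f, G.faceChain l f = G.insideChain (Finset.univ.image g) := by
  classical
  set U := Finset.univ.image g with hU
  have hnon : ∀ u v, ¬ G.Adj u v → G.insideChain U u v = 0 := fun u v h => by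
    rw [insideChain, if_neg (fun h' => h h'.1)]
  -- The pentagon is the coboundary of some `w`. The aim is that `w` takes a single value `t` on
  -- both sides of every edge off the pentagon; a face with a different value then has its whole
  -- boundary on the pentagon.
  obtain ⟨w, hw⟩ := (hl _ (insideChain_comm G U) hnon).1 (hg.sum_insideChain h4)
  have hout : ∀ u v, u ∉ U → G.Adj u v → w (l u v) = w (l v u) := by
    intro u v hu huv
    have := hw u v huv
    rw [insideChain, if_neg (fun h => hu h.2.1)] at this
    exact CharTwo.add_eq_zero.1 this.symm
  -- A path from `x` to `y` avoiding `v` is closed up through `v` to an even set `D`, the coboundary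
  -- of some `wD`. The coboundary `D'` of the product of `w` and `wD` is even as well. Since `w`
  -- agrees on the two sides of each edge at `v`, the chain `D'` at `v` is `w` times `D`, so
  -- evenness at `v` compares exactly the values for `x` and `y`.
  have hvert : ∀ v x y, v ∉ U → G.Adj v x → G.Adj v y → w (l v x) = w (l v y) := by
    intro v x y hv hx hy
    obtain ⟨J, hJs, hJB, -, hJd⟩ := exists_join (nb := fun p => Finset.univ.filter (G.Adj p))
      (by intro p q; simp [G.adj_comm]) (B := {p | p ≠ v}) (x := x) (y := y)
      (ReflTransGen.mono (by intro p q; simp) _ _ (h1 v x y hx hy))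
    have hJn : ∀ p q, ¬ G.Adj p q → J p q = 0 := by
      intro p q hpq
      by_contra hne
      have := (hJB p q hne).2.2
      simp [hpq] at this
    have hJd' : ∀ p, ∑ q, J p q = (if p = x then 1 else 0) + (if p = y then 1 else 0) := by
      intro p
      rw [← hJd p]
      symm
      apply Finset.sum_subset (Finset.subset_univ _)
      intro q _ hq
      apply hJn
      simpa using hq
    have hJv : ∀ q, J v q = 0 := by
      intro q
      by_contra hne
      exact (hJB v q hne).1 rfl
    let E : V → V → V → ZMod 2 := fun a p q =>
      (if p = v ∧ q = a then 1 else 0) + (if p = a ∧ q = v then 1 else 0)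
    have hEs : ∀ a p q, E a p q = E a q p := by
      intro a p q
      simp only [E, and_comm (a := q = v), and_comm (a := q = a)]
      ring
    have hEn : ∀ a, G.Adj v a → ∀ p q, ¬ G.Adj p q → E a p q = 0 := by
      intro a ha p q hpq
      simp only [E]
      rw [if_neg, if_neg, add_zero]
      · rintro ⟨rfl, rfl⟩; exact hpq ha.symm
      · rintro ⟨rfl, rfl⟩; exact hpq ha
    have hEd : ∀ a p, ∑ q, E a p q = (if p = v then 1 else 0) + (if p = a then 1 else 0) := by
      intro a p
      simp only [E, Finset.sum_add_distrib]
      congr 1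
      · by_cases h : p = v <;> simp [h]
      · by_cases h : p = a <;> simp [h]
    let D : V → V → ZMod 2 := fun p q => J p q + E x p q + E y p q
    have hDs : ∀ p q, D p q = D q p := fun p q => by
      simp only [D]; rw [hJs, hEs x, hEs y]
    have hDn : ∀ p q, ¬ G.Adj p q → D p q = 0 := fun p q h => by
      simp only [D]; rw [hJn _ _ h, hEn x hx _ _ h, hEn y hy _ _ h]; rfl
    have hDe : ∀ p, ∑ q, D p q = 0 := by
      intro p
      simp only [D, Finset.sum_add_distrib, hJd', hEd]
      generalize (if p = x then (1 : ZMod 2) else 0) = a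
      generalize (if p = y then (1 : ZMod 2) else 0) = b
      generalize (if p = v then (1 : ZMod 2) else 0) = c
      revert a b c; decide
    obtain ⟨wD, hwD⟩ := (hl D hDs hDn).1 hDe
    let D' : V → V → ZMod 2 := fun p q => if G.Adj p q then
      w (l p q) * wD (l p q) + w (l q p) * wD (l q p) else 0
    have hD's : ∀ p q, D' p q = D' q p := fun p q => by
      simp only [D', G.adj_comm p q]; rw [add_comm]
    have hD'e := (hl D' hD's (fun p q h => by simp [D', h])).2
      ⟨fun f => w f * wD f, fun p q h => by simp [D', h]⟩ v
    have hD'v : ∀ q, D' v q = (if q = x then w (l v x) else 0) + (if q = y then w (l v y) else 0)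
        := by
      intro q
      by_cases hq : G.Adj v q
      · have e := hwD v q hq
        simp only [D', hq, if_true, ← hout v q hv hq]
        rw [← mul_add, ← e]
        simp only [D, E, hJv, true_and, zero_add, hx.ne, hy.ne, false_and, if_false, add_zero]
        rw [mul_add]
        congr 1
        · split_ifs with h
          · rw [h, mul_one]
          · simp
        · split_ifs with h
          · rw [h, mul_one]
          · simp
      · have n1 : q ≠ x := by rintro rfl; exact hq hx
        have n2 : q ≠ y := by rintro rfl; exact hq hy
        simp [D', hq, n1, n2]
    simp only [hD'v, Finset.sum_add_distrib, Finset.sum_ite_eq', Finset.mem_univ, if_true] at hD'e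
    exact CharTwo.add_eq_zero.1 hD'e
  -- The value spreads around a vertex by `hvert` and across an edge off the pentagon by `hout`,
  -- along the connected complement.
  obtain ⟨t, ht⟩ : ∃ t, ∀ v q, v ∉ U → G.Adj v q → w (l v q) = t := by
    by_cases hex : ∃ v q, v ∉ U ∧ G.Adj v q
    · obtain ⟨v, q, hv, hq⟩ := hex
      refine ⟨w (l v q), fun v' q' hv' hq' => ?_⟩
      have hpath := h2 v v' q q' hq hq' hv hv'
      have : ∀ r, ReflTransGen (fun p q => p ∉ U ∧ q ∉ U ∧ G.Adj p q) v r → r ∉ U →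
          ∀ s, G.Adj r s → w (l r s) = w (l v q) := by
        intro r hr
        induction hr with
        | refl => intro _ s hs; exact hvert v s q hv hs hq
        | @tail b c _ hbc ih =>
          intro hc s hs
          rw [hvert c s b hc hs hbc.2.2.symm, hout c b hc hbc.2.2.symm]
          exact ih hbc.1 c hbc.2.2
      exact this v' hpath hv' q' hq'
    · push Not at hex
      exact ⟨0, fun v q hv hq => (hex v q hv hq).elim⟩
  have ht' : ∀ u v, G.Adj u v → ¬ (u ∈ U ∧ v ∈ U) → w (l u v) = t := by
    intro u v huv hnot
    by_cases hu : u ∈ U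
    · have hv : v ∉ U := fun hv => hnot ⟨hu, hv⟩
      rw [← hout v u hv huv.symm]
      exact ht v u hv huv.symm
    · exact ht u v hu huv
  have h01 := hw _ _ (hg.2 0)
  rw [hg.insideChain_succ] at h01
  -- The two sides of a pentagon edge have different values of `w`, so one of them differs from `t`.
  obtain ⟨f, hft, hf⟩ : ∃ f, w f ≠ t ∧ G.faceChain l f (g 0) (g (0 + 1)) ≠ 0 := by
    simp only [faceChain, hg.2 0, if_true]
    by_cases h : w (l (g 0) (g (0 + 1))) = t
    · refine ⟨l (g (0 + 1)) (g 0), fun h' => ?_, ?_⟩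
      · rw [h, h', CharTwo.add_self_eq_zero] at h01; exact one_ne_zero h01
      · rw [if_neg, if_pos rfl]
        · simp
        · intro h'
          rw [h', CharTwo.add_self_eq_zero] at h01; exact one_ne_zero h01
    · refine ⟨l (g 0) (g (0 + 1)), h, ?_⟩
      rw [if_pos rfl, if_neg]
      · simp
      · intro h'
        rw [h', CharTwo.add_self_eq_zero] at h01; exact one_ne_zero h01
  refine ⟨f, hg.eq_insideChain h4 (faceChain_comm G l f) (hl.sum_faceChain f) ?_ hf⟩
  intro u v huv
  by_cases hadj : G.Adj u v
  · have hnot : ¬ (u ∈ U ∧ v ∈ U) := by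
      intro h
      rw [insideChain, if_pos ⟨hadj, h.1, h.2⟩] at huv
      exact one_ne_zero huv
    have a1 := ht' u v hadj hnot
    have a2 := ht' v u hadj.symm (fun h => hnot h.symm)
    have b1 : l u v ≠ f := by rintro rfl; exact hft a1
    have b2 : l v u ≠ f := by rintro rfl; exact hft a2
    simp [faceChain, b1, b2]
  · exact faceChain_of_not_adj G l f hadj

lemma insideChain_injOn_pentagons {G : SimpleGraph V} :
    Set.InjOn G.insideChain (G.pentagons : Set (Finset V)) := by
  have key : ∀ U ∈ G.pentagons, ∀ U', G.insideChain U = G.insideChain U' → U ⊆ U' := by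
    intro U hU U' h x hx
    obtain ⟨f, hf, rfl⟩ := mem_pentagons.1 hU
    simp only [Finset.mem_image, Finset.mem_univ, true_and] at hx
    obtain ⟨i, rfl⟩ := hx
    have e := congrFun (congrFun h (f i)) (f (i + 1))
    have e1 : G.insideChain (Finset.univ.image f) (f i) (f (i + 1)) = 1 := hf.insideChain_succ i
    have e2 : G.insideChain U' (f i) (f (i + 1)) = 1 := by
      rw [← e]; convert e1
    rw [insideChain] at e2
    by_contra hn
    rw [if_neg (fun h => hn h.2.1)] at e2
    exact zero_ne_one e2
  intro U hU U' hU' h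
  exact Finset.Subset.antisymm (key U hU U' h) (key U' hU' U h.symm)

end SimpleGraph

/-! ### Euler's inequality and the count of face lengths. -/

namespace SimpleGraph

section Counting

variable {V : Type*} [Fintype V]

/-- Extend a function on the edges to a symmetric function on pairs of vertices. -/
noncomputable def edgeChain {V : Type*} (G : SimpleGraph V) (z : G.edgeSet → ZMod 2) (u v : V) : ZMod 2 :=
  open Classical in if h : G.Adj u v then z ⟨s(u, v), h⟩ else 0

lemma edgeChain_comm {V : Type*} (G : SimpleGraph V) (z : G.edgeSet → ZMod 2) (u v : V) :
    G.edgeChain z u v = G.edgeChain z v u := by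
  by_cases h : G.Adj u v
  · simp [edgeChain, h, h.symm, Sym2.eq_swap (a := u)]
  · rw [edgeChain, edgeChain, dif_neg h, dif_neg (fun h' => h h'.symm)]

/-- The degrees modulo two of an edge set. -/
noncomputable def boundary (G : SimpleGraph V) : (G.edgeSet → ZMod 2) →ₗ[ZMod 2] (V → ZMod 2) where
  toFun z u := ∑ v, G.edgeChain z u v
  map_add' z z' := by
    ext u
    simp only [Pi.add_apply, ← Finset.sum_add_distrib]
    refine Finset.sum_congr rfl fun v _ => ?_
    by_cases h : G.Adj u v <;> simp [edgeChain, h]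
  map_smul' c z := by
    ext u
    simp only [Pi.smul_apply, smul_eq_mul, RingHom.id_apply, Finset.mul_sum]
    refine Finset.sum_congr rfl fun v _ => ?_
    by_cases h : G.Adj u v <;> simp [edgeChain, h]

/-- The coboundary of a face as a function on the edges. -/
noncomputable def faceVector (G : SimpleGraph V) {F : Type*} (l : V → V → F) (f : F)
    (e : G.edgeSet) : ZMod 2 :=
  Sym2.lift ⟨G.faceChain l f, faceChain_comm G l f⟩ e.1

-- By the handshake lemma the degrees modulo two sum to zero on `S`, so they are combinations of the
-- vectors δ_u + δ_{u₀} with u ≠ u₀ in `S`.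
open Classical in
lemma finrank_range_boundary_le (G : SimpleGraph V) {S : Finset V} (hS : ∀ u v, G.Adj u v → u ∈ S)
    {u₀ : V} (hu₀ : u₀ ∈ S) :
    Module.finrank (ZMod 2) (LinearMap.range G.boundary) + 1 ≤ S.card := by
  let b : V → V → ZMod 2 := fun u => Pi.single u 1 + Pi.single u₀ 1
  have hle : LinearMap.range G.boundary ≤ Submodule.span (ZMod 2)
      ((((S.erase u₀).image b : Finset (V → ZMod 2))) : Set (V → ZMod 2)) := by
    rintro _ ⟨z, rfl⟩
    set c := G.boundary z with hc
    have hsum : ∑ u, c u = 0 := by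
      refine sum_sum_eq_zero_of_symm Finset.univ (G.edgeChain z) (edgeChain_comm G z) ?_
      intro p; simp [edgeChain]
    have hsupp : ∀ u, u ∉ S → c u = 0 := by
      intro u hu
      refine Finset.sum_eq_zero fun v _ => ?_
      rw [edgeChain, dif_neg (fun h => hu (hS u v h))]
    have hS0 : ∑ u ∈ S.erase u₀, c u = c u₀ := by
      have h1 : ∑ u ∈ S, c u = 0 := by
        rw [← hsum]
        exact Finset.sum_subset (Finset.subset_univ _) (fun u _ hu => hsupp u hu)
      rw [← Finset.add_sum_erase _ _ hu₀] at h1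
      exact (CharTwo.add_eq_zero.1 h1).symm
    have : c = ∑ u ∈ S.erase u₀, c u • b u := by
      ext x
      rw [Finset.sum_apply]
      simp only [b, Pi.smul_apply, Pi.add_apply, smul_eq_mul, mul_add, Finset.sum_add_distrib,
        Pi.single_apply, mul_ite, mul_one, mul_zero, Finset.sum_ite_eq]
      by_cases hx : x = u₀
      · subst hx; simp [hS0]
      · by_cases hxS : x ∈ S
        · simp [hx, hxS]
        · simp [hx, hxS, hsupp x hxS]
    rw [this]
    exact Submodule.sum_mem _ fun u hu => Submodule.smul_mem _ _ (Submodule.subset_span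
      (Finset.mem_coe.2 (Finset.mem_image_of_mem _ hu)))
  have h1 := Submodule.finrank_mono hle
  have h2 := finrank_span_finset_le_card (R := ZMod 2) ((S.erase u₀).image b)
  have h3 : ((S.erase u₀).image b).card ≤ (S.erase u₀).card := Finset.card_image_le
  have h4 := Finset.card_erase_add_one hu₀
  rw [Set.finrank] at h2
  omega

-- Even edge sets are coboundaries, hence combinations of face vectors. Every edge has two sides, so
-- the face vectors sum to zero and one nonzero face can be dropped. A nonzero face has to be
-- assumed, as a forest has none.
open Classical in
lemma IsDual.finrank_ker_boundary_le {G : SimpleGraph V} {F : Type*} [Fintype F] {l : V → V → F}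
    (hl : G.IsDual l) {f₀ : F} (hf₀ : G.faceChain l f₀ ≠ 0) :
    Module.finrank (ZMod 2) (LinearMap.ker G.boundary) + 1 ≤
      (Finset.univ.filter (fun f => G.faceChain l f ≠ 0)).card := by
  set F' := Finset.univ.filter (fun f => G.faceChain l f ≠ 0) with hF'
  have hmem : f₀ ∈ F' := by simp [hF', hf₀]
  have hzero : ∀ f, f ∉ F' → G.faceVector l f = 0 := by
    intro f hf
    have hf : G.faceChain l f = 0 := by simpa [hF'] using hf
    ext ⟨e, he⟩
    induction e with
    | _ u v => simp [faceVector, hf]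
  have hval : ∀ f u v (h : G.Adj u v), G.faceVector l f ⟨s(u, v), h⟩ =
      (if l u v = f then 1 else 0) + (if l v u = f then 1 else 0) := by
    intro f u v h
    simp [faceVector, faceChain, h]
  have htot : ∑ f ∈ F', G.faceVector l f = 0 := by
    rw [Finset.sum_subset (Finset.subset_univ F') (fun f _ hf => hzero f hf)]
    ext ⟨e, he⟩
    induction e with
    | _ u v =>
      rw [Finset.sum_apply]
      simp only [hval _ u v he, Finset.sum_add_distrib, Finset.sum_ite_eq, Finset.mem_univ,
        if_true]
      exact CharTwo.add_self_eq_zero _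
  have hf₀e : G.faceVector l f₀ = ∑ f ∈ F'.erase f₀, G.faceVector l f := by
    rw [← Finset.add_sum_erase _ _ hmem] at htot
    ext e
    have := congrFun htot e
    exact CharTwo.add_eq_zero.1 this
  have hin : ∀ f, G.faceVector l f ∈ Submodule.span (ZMod 2)
      ((((F'.erase f₀).image (G.faceVector l) : Finset (G.edgeSet → ZMod 2))) :
        Set (G.edgeSet → ZMod 2)) := by
    have h1 : ∀ f ∈ F'.erase f₀, G.faceVector l f ∈ Submodule.span (ZMod 2)
      ((((F'.erase f₀).image (G.faceVector l) : Finset (G.edgeSet → ZMod 2))) :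
        Set (G.edgeSet → ZMod 2)) := fun f hf => Submodule.subset_span
          (Finset.mem_coe.2 (Finset.mem_image_of_mem _ hf))
    intro f
    by_cases hf : f ∈ F'
    · by_cases h0 : f = f₀
      · subst h0
        rw [hf₀e]
        exact Submodule.sum_mem _ h1
      · exact h1 f (Finset.mem_erase.2 ⟨h0, hf⟩)
    · rw [hzero f hf]; exact Submodule.zero_mem _
  have hle : LinearMap.ker G.boundary ≤ Submodule.span (ZMod 2)
      ((((F'.erase f₀).image (G.faceVector l) : Finset (G.edgeSet → ZMod 2))) :
        Set (G.edgeSet → ZMod 2)) := by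
    intro z hz
    have hz : ∀ u, ∑ v, G.edgeChain z u v = 0 := fun u => congrFun (LinearMap.mem_ker.1 hz) u
    obtain ⟨w, hw⟩ := (hl _ (edgeChain_comm G z) (fun u v h => by simp [edgeChain, h])).1 hz
    have : z = ∑ f, w f • G.faceVector l f := by
      ext ⟨e, he⟩
      induction e with
      | _ u v =>
        have := hw u v he
        have he' : G.Adj u v := he
        rw [edgeChain, dif_pos he'] at this
        refine Eq.trans this ?_
        rw [Finset.sum_apply]
        simp only [Pi.smul_apply, smul_eq_mul, hval _ u v he, mul_add, mul_ite, mul_one, mul_zero,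
          Finset.sum_add_distrib, Finset.sum_ite_eq, Finset.mem_univ, if_true]
    rw [this]
    exact Submodule.sum_mem _ fun f _ => Submodule.smul_mem _ _ (hin f)
  have h1 := Submodule.finrank_mono hle
  have h2 := finrank_span_finset_le_card (R := ZMod 2) ((F'.erase f₀).image (G.faceVector l))
  have h3 : ((F'.erase f₀).image (G.faceVector l)).card ≤ (F'.erase f₀).card :=
    Finset.card_image_le
  have h4 := Finset.card_erase_add_one hmem
  rw [Set.finrank] at h2
  omega

open Classical in
/-- Euler's inequality. -/
lemma IsDual.card_edgeSet_add_two_le {G : SimpleGraph V} {F : Type*} [Fintype F] {l : V → V → F}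
    (hl : G.IsDual l) {f₀ : F} (hf₀ : G.faceChain l f₀ ≠ 0) {S : Finset V}
    (hS : ∀ u v, G.Adj u v → u ∈ S) (hne : S.Nonempty) :
    Fintype.card G.edgeSet + 2 ≤
      S.card + (Finset.univ.filter (fun f => G.faceChain l f ≠ 0)).card := by
  obtain ⟨u₀, hu₀⟩ := hne
  have h1 := finrank_range_boundary_le G hS hu₀
  have h2 := hl.finrank_ker_boundary_le hf₀
  -- Rank plus nullity bounds the number of edges by (|S| - 1) + (number of nonzero faces - 1).
  have h3 := LinearMap.finrank_range_add_finrank_ker G.boundary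
  rw [Module.finrank_fintype_fun_eq_card] at h3
  omega

open Classical in
/-- The edges on the boundary of a face. -/
noncomputable def faceEdges (G : SimpleGraph V) {F : Type*} (l : V → V → F) (f : F) :
    Finset G.edgeSet :=
  Finset.univ.filter (fun e => G.faceVector l f e ≠ 0)

lemma mem_faceEdges {G : SimpleGraph V} {F : Type*} {l : V → V → F} {f : F} {u v : V}
    (h : G.Adj u v) : (⟨s(u, v), h⟩ : G.edgeSet) ∈ G.faceEdges l f ↔ G.faceChain l f u v ≠ 0 := by
  rw [faceEdges, Finset.mem_filter]
  exact ⟨fun h => h.2, fun h => ⟨@Finset.mem_univ _ (_) _, h⟩⟩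

-- An edge lies on no faces besides those to the left of its two darts.
open Classical in
lemma sum_card_faceEdges_le (G : SimpleGraph V) {F : Type*} [Fintype F] (l : V → V → F)
    (F' : Finset F) : ∑ f ∈ F', (G.faceEdges l f).card ≤ 2 * Fintype.card G.edgeSet := by
  have h1 := Finset.sum_card_bipartiteAbove_eq_sum_card_bipartiteBelow
    (s := F') (t := (Finset.univ : Finset G.edgeSet)) (fun f e => G.faceVector l f e ≠ 0)
  simp only [Finset.bipartiteAbove, Finset.bipartiteBelow] at h1
  have h2 : ∀ e : G.edgeSet, (F'.filter (fun f => G.faceVector l f e ≠ 0)).card ≤ 2 := by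
    rintro ⟨e, he⟩
    induction e with
    | _ u v =>
      refine le_trans (Finset.card_le_card (t := {l u v, l v u}) ?_) Finset.card_le_two
      intro f hf
      have hadj : G.Adj u v := he
      have hf := (Finset.mem_filter.1 hf).2
      simp only [faceVector, Sym2.lift_mk, faceChain, hadj, if_true] at hf
      by_contra hn
      simp only [Finset.mem_insert, Finset.mem_singleton, not_or] at hn
      rw [if_neg (Ne.symm hn.1), if_neg (Ne.symm hn.2)] at hf
      exact hf (add_zero _)
  calc ∑ f ∈ F', (G.faceEdges l f).card
      = ∑ e : G.edgeSet, (F'.filter (fun f => G.faceVector l f e ≠ 0)).card := by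
        rw [← h1]; rfl
    _ ≤ ∑ _e : G.edgeSet, 2 := Finset.sum_le_sum fun e _ => h2 e
    _ = 2 * Fintype.card G.edgeSet := by simp [mul_comm]

lemma exists_ne_of_sum_eq_zero {z : V → ZMod 2} (h : ∑ v, z v = 0) {a : V} (ha : z a ≠ 0) :
    ∃ b, b ≠ a ∧ z b ≠ 0 := by
  classical
  by_contra! hcon
  rw [Finset.sum_eq_single a (fun b _ hb => hcon b hb) (by simp)] at h
  exact ha h

-- A face boundary is even, so an edge `uv` of it comes with a second edge at `u` and a second edge
-- at `v`, and the three are distinct in a simple graph.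
open Classical in
lemma IsDual.three_le_card_faceEdges {G : SimpleGraph V} {F : Type*} {l : V → V → F}
    (hl : G.IsDual l) {f : F} (hf : G.faceChain l f ≠ 0) : 3 ≤ (G.faceEdges l f).card := by
  have hadj : ∀ {u v}, G.faceChain l f u v ≠ 0 → G.Adj u v := fun {u v} h => by
    by_contra hn; exact h (faceChain_of_not_adj G l f hn)
  obtain ⟨u, hu⟩ := Function.ne_iff.1 hf
  obtain ⟨v, huv⟩ := Function.ne_iff.1 hu
  have huv : G.faceChain l f u v ≠ 0 := huv
  obtain ⟨v', hv', huv'⟩ := exists_ne_of_sum_eq_zero (hl.sum_faceChain f u) huv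
  obtain ⟨u', hu', hvu'⟩ := exists_ne_of_sum_eq_zero (hl.sum_faceChain f v) (a := u)
    (by rwa [faceChain_comm])
  refine le_trans (le_of_eq ?_) (Finset.card_le_card
    (s := {⟨s(u, v), hadj huv⟩, ⟨s(u, v'), hadj huv'⟩, ⟨s(v, u'), hadj hvu'⟩}) ?_)
  · symm
    rw [Finset.card_eq_three]
    refine ⟨_, _, _, ?_, ?_, ?_, rfl⟩
    · intro h
      have := (Subtype.mk.injEq .. ▸ h : s(u, v) = s(u, v'))
      rw [Sym2.eq_iff] at this
      have := (hadj huv).ne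
      grind
    · intro h
      have := (Subtype.mk.injEq .. ▸ h : s(u, v) = s(v, u'))
      rw [Sym2.eq_iff] at this
      have := (hadj huv).ne
      grind
    · intro h
      have := (Subtype.mk.injEq .. ▸ h : s(u, v') = s(v, u'))
      rw [Sym2.eq_iff] at this
      have := (hadj huv).ne
      grind
  · intro e he
    simp only [Finset.mem_insert, Finset.mem_singleton] at he
    rcases he with rfl | rfl | rfl <;> rw [mem_faceEdges] <;> assumption

open Classical in
lemma IsPentagon.five_le_card_faceEdges {G : SimpleGraph V} {F : Type*} {l : V → V → F}
    {g : Fin 5 → V} (hg : G.IsPentagon g) {f : F}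
    (hf : G.faceChain l f = G.insideChain (Finset.univ.image g)) :
    5 ≤ (G.faceEdges l f).card := by
  have hinj : Function.Injective (fun i => (⟨s(g i, g (i + 1)), hg.2 i⟩ : G.edgeSet)) := by
    intro i j h
    have := (Subtype.mk.injEq .. ▸ h : s(g i, g (i + 1)) = s(g j, g (j + 1)))
    rw [Sym2.eq_iff, hg.1.eq_iff, hg.1.eq_iff, hg.1.eq_iff, hg.1.eq_iff] at this
    exact (by decide : ∀ i j : Fin 5, i = j ∧ i + 1 = j + 1 ∨ i = j + 1 ∧ i + 1 = j → i = j) i j this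
  have h5 : (Finset.univ.image (fun i => (⟨s(g i, g (i + 1)), hg.2 i⟩ : G.edgeSet))).card = 5 := by
    rw [Finset.card_image_of_injective _ hinj]; simp
  rw [← h5]
  apply Finset.card_le_card
  intro e he
  simp only [Finset.mem_image, Finset.mem_univ, true_and] at he
  obtain ⟨i, rfl⟩ := he
  rw [mem_faceEdges, hf, hg.insideChain_succ]
  exact one_ne_zero

open Classical in
/-- The bound when every pentagon bounds a face. -/
lemma IsDual.card_pentagons_le {G : SimpleGraph V} {F : Type*} [Fintype F]
    {l : V → V → F} (hl : G.IsDual l) {S : Finset V} (hS : ∀ u v, G.Adj u v → u ∈ S)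
    (hface : ∀ U ∈ G.pentagons, ∃ f, G.faceChain l f = G.insideChain U) :
    G.pentagons.card ≤ S.card - 4 := by
  by_contra! hcon
  have hne : G.pentagons.Nonempty := Finset.card_pos.1 (by omega)
  have : Nonempty F := hne.elim fun U hU => ⟨(hface U hU).choose⟩
  choose! φ hφ using hface
  have hsub : ∀ U ∈ G.pentagons, U ⊆ S := by
    intro U hU x hx
    obtain ⟨f, hf, rfl⟩ := mem_pentagons.1 hU
    simp only [Finset.mem_image, Finset.mem_univ, true_and] at hx
    obtain ⟨i, rfl⟩ := hx
    exact hS _ _ (hf.2 i)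
  have hinj : Set.InjOn φ (G.pentagons : Set (Finset V)) := by
    intro U hU U' hU' h
    apply insideChain_injOn_pentagons hU hU'
    rw [← hφ U hU, ← hφ U' hU', h]
  set F' := Finset.univ.filter (fun f => G.faceChain l f ≠ 0) with hF'
  set A := G.pentagons.image φ with hA
  have hAcard : A.card = G.pentagons.card := Finset.card_image_of_injOn hinj
  have hA5 : ∀ f ∈ A, 5 ≤ (G.faceEdges l f).card := by
    intro f hf
    obtain ⟨U, hU, rfl⟩ := Finset.mem_image.1 hf
    obtain ⟨g, hg, hgU⟩ := mem_pentagons.1 hU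
    apply hg.five_le_card_faceEdges
    rw [hφ U hU, hgU]
  have hAF : A ⊆ F' := by
    intro f hf
    rw [hF', Finset.mem_filter]
    refine ⟨Finset.mem_univ _, fun h0 => ?_⟩
    have := hA5 f hf
    rw [faceEdges, Finset.filter_false_of_mem] at this
    · simp at this
    · rintro ⟨e, he⟩ -
      induction e with
      | _ u v => simp [faceVector, h0]
  obtain ⟨U₀, hU₀⟩ := hne
  have hf₀ : G.faceChain l (φ U₀) ≠ 0 :=
    (Finset.mem_filter.1 (hAF (Finset.mem_image_of_mem _ hU₀))).2
  have hU₀card := card_of_mem_pentagons hU₀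
  have hSne : S.Nonempty := (Finset.card_pos.1 (by omega : 0 < U₀.card)).mono (hsub U₀ hU₀)
  have e1 := hl.card_edgeSet_add_two_le hf₀ hS hSne
  have e2 := sum_card_faceEdges_le G l F'
  rw [← Finset.sum_sdiff hAF] at e2
  have e3 : (F' \ A).card * 3 ≤ ∑ f ∈ F' \ A, (G.faceEdges l f).card := by
    rw [← smul_eq_mul]
    refine Finset.card_nsmul_le_sum _ _ _ fun f hf => hl.three_le_card_faceEdges ?_
    exact (Finset.mem_filter.1 (Finset.mem_sdiff.1 hf).1).2
  have e4 : A.card * 5 ≤ ∑ f ∈ A, (G.faceEdges l f).card := by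
    rw [← smul_eq_mul]
    exact Finset.card_nsmul_le_sum _ _ _ hA5
  have e5 := Finset.card_sdiff_add_card_eq_card hAF
  have e6 : 5 ≤ S.card := hU₀card ▸ Finset.card_le_card (hsub U₀ hU₀)
  -- With p pentagonal faces and q others, the inequalities give 3p + q ≤ 2|S| - 4. Together with p
  -- ≥ |S| - 3 and |S| ≥ 5 this leaves only |S| = 5 and p = 2, where both pentagons would have
  -- vertex set `S`.
  have e7 : G.pentagons.card = 2 := by rw [← hF'] at e1; omega
  obtain ⟨U, U', hUU, hpent⟩ := Finset.card_eq_two.1 e7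
  have hU : U ∈ G.pentagons := by rw [hpent]; simp
  have hU' : U' ∈ G.pentagons := by rw [hpent]; simp
  have e8 : S.card = 5 := by omega
  have c1 := Finset.eq_of_subset_of_card_le (hsub U hU) (by rw [card_of_mem_pentagons hU, e8])
  have c2 := Finset.eq_of_subset_of_card_le (hsub U' hU') (by rw [card_of_mem_pentagons hU', e8])
  exact hUU (c1.trans c2.symm)

end Counting

/-! ### The induction along separations. -/

/-- A graph without `4`-cycles all of whose subgraphs have abstract duals has at most `n - 4`
pentagons. -/
theorem card_pentagons_le {V : Type*} [Fintype V] {G : SimpleGraph V}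
    (hd : ∀ H ≤ G, H.HasDual) (h4 : G.NoSquare) {S : Finset V} (hS : ∀ u v, G.Adj u v → u ∈ S) :
    G.pentagons.card ≤ S.card - 4 := by
  classical
  induction hn : S.card using Nat.strong_induction_on generalizing G S with
  | _ n ih =>
  subst hn
  have ih' : ∀ T : Finset V, T ⊂ S → (G.restrict T).pentagons.card ≤ T.card - 4 := by
    intro T hT
    exact ih _ (Finset.card_lt_card hT) (fun H hH => hd H (hH.trans (G.restrict_le T)))
      (h4.mono (G.restrict_le T)) (fun u v h => h.2.1) rfl
  -- an unreachable pair of vertices off `T` gives a separation along `T`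
  have hsep : ∀ T : Finset V, T ⊆ S → (T.card ≤ 1 ∨ T ∈ G.pentagons) → ∀ x ∈ S, ∀ y ∈ S, x ∉ T →
      y ∉ T → ¬ ReflTransGen (fun p q => p ∉ T ∧ q ∉ T ∧ G.Adj p q) x y →
      G.pentagons.card ≤ S.card - 4 := by
    intro T hTS hT x hx y hy hxT hyT hxy
    -- `R` is the part reachable from `x` off `T`. The sides `R ∪ T` and `S \ R` meet exactly in
    -- `T`; the first misses `y` and the second misses `x`, so induction applies to both.
    set R := S.filter (fun p => p ∉ T ∧
      ReflTransGen (fun p q => p ∉ T ∧ q ∉ T ∧ G.Adj p q) x p) with hR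
    have hRS : R ⊆ S := Finset.filter_subset _ _
    have hRT : ∀ p ∈ R, p ∉ T := fun p hp => (Finset.mem_filter.1 hp).2.1
    have hxR : x ∈ R := Finset.mem_filter.2 ⟨hx, hxT, ReflTransGen.refl⟩
    have hyR : y ∉ R := fun h => hxy (Finset.mem_filter.1 h).2.2
    have hinter : (R ∪ T) ∩ (S \ R) = T := by
      ext p
      have := hRT p
      have := @hTS p
      simp only [Finset.mem_inter, Finset.mem_union, Finset.mem_sdiff]
      tauto
    refine card_pentagons_le_of_separation h4 (S₁ := R ∪ T) (S₂ := S \ R) ?_ ?_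
      (by rwa [hinter]) (ih' _ ?_) (ih' _ ?_)
    · ext p
      have := @hRS p
      have := @hTS p
      simp only [Finset.mem_union, Finset.mem_sdiff]
      tauto
    · intro u v huv
      have huS := hS u v huv
      have hvS := hS v u huv.symm
      have step : ∀ a b, G.Adj a b → b ∈ S → a ∈ R → b ∈ R ∪ T := by
        intro a b hab hb ha
        by_cases hbT : b ∈ T
        · exact Finset.mem_union_right _ hbT
        · have ha' := (Finset.mem_filter.1 ha).2
          exact Finset.mem_union_left _ (Finset.mem_filter.2
            ⟨hb, hbT, ha'.2.tail ⟨ha'.1, hbT, hab⟩⟩)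
      have s1 := step u v huv hvS
      have s2 := step v u huv.symm huS
      by_cases hu : u ∈ R
      · exact Or.inl ⟨Finset.mem_union_left _ hu, s1 hu⟩
      · by_cases hv : v ∈ R
        · exact Or.inl ⟨s2 hv, Finset.mem_union_left _ hv⟩
        · exact Or.inr ⟨Finset.mem_sdiff.2 ⟨huS, hu⟩, Finset.mem_sdiff.2 ⟨hvS, hv⟩⟩
    · refine Finset.ssubset_iff_of_subset (Finset.union_subset hRS hTS) |>.2 ⟨y, hy, ?_⟩
      simp [hyR, hyT]
    · refine Finset.ssubset_iff_of_subset Finset.sdiff_subset |>.2 ⟨x, hx, ?_⟩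
      simp [hxR]
  by_contra hcon
  obtain ⟨F, _, l, hl⟩ := hd G le_rfl
  refine hcon (hl.card_pentagons_le hS fun U hU => ?_)
  obtain ⟨g, hg, rfl⟩ := mem_pentagons.1 hU
  have hUS : Finset.univ.image g ⊆ S := by
    intro x hx
    simp only [Finset.mem_image, Finset.mem_univ, true_and] at hx
    obtain ⟨i, rfl⟩ := hx
    exact hS _ _ (hg.2 i)
  refine hl.exists_faceChain_eq h4 hg (fun v x y hx hy => ?_) (fun x y x' y' hx hy hxU hyU => ?_)
  · by_contra hr
    refine hcon (hsep {v} (by simpa using hS v x hx) (by simp) x (hS x v hx.symm) y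
      (hS y v hy.symm) (by simpa using hx.ne') (by simpa using hy.ne') ?_)
    simpa using hr
  · by_contra hr
    exact hcon (hsep _ hUS (Or.inr hU) x (hS x x' hx) y (hS y y' hy) hxU hyU hr)

end SimpleGraph

/-! ### Abstract duals of minors. -/

namespace SimpleGraph

/-- Abstract duality passes from a locally finite graph, given by its neighbour sets `nb`, to its
finite minors, given by finite connected branch sets `B` and darts `(a u v, a v u)` joining them. -/
lemma exists_isDual_of_minor {V W : Type*} {F : Type} [Fintype V] [DecidableEq W] {G : SimpleGraph V}
    {nb : W → Finset W} (hnb : ∀ p q, q ∈ nb p → p ∈ nb q) (hirr : ∀ p, p ∉ nb p) {l : W → W → F}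
    (hsum : ∀ (w : F → ZMod 2) (p : W), ∑ q ∈ nb p, (w (l p q) + w (l q p)) = 0)
    (hz : ∀ z : W → W → ZMod 2, (∀ p q, z p q = z q p) → (∀ p q, q ∉ nb p → z p q = 0) →
      {p | ∃ q, z p q ≠ 0}.Finite → (∀ p, ∑ q ∈ nb p, z p q = 0) →
      ∃ w : F → ZMod 2, ∀ p, ∀ q ∈ nb p, z p q = w (l p q) + w (l q p))
    (B : V → Finset W) (hdisj : ∀ u v p, p ∈ B u → p ∈ B v → u = v) (r : V → W)
    (hconn : ∀ u, ∀ p ∈ B u, ReflTransGen (fun p q => p ∈ B u ∧ q ∈ B u ∧ q ∈ nb p) p (r u))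
    (a : V → V → W) (ha : ∀ u v, G.Adj u v → a u v ∈ B u ∧ a u v ∈ nb (a v u)) :
    ∃ (F' : Type) (l' : V → V → F'), G.IsDual l' := by
  classical
  -- Contracting an edge leaves the faces alone, while deleting one merges its two sides. So `R`
  -- identifies the sides of the edges that are neither inside a branch set nor chosen.
  let R : F → F → Prop := fun f f' => ∃ p q, q ∈ nb p ∧ (∀ v, ¬ (p ∈ B v ∧ q ∈ B v)) ∧
    (∀ u v, G.Adj u v → ¬ (p = a u v ∧ q = a v u)) ∧ f = l p q ∧ f' = l q p
  refine ⟨Quot R, fun u v => Quot.mk R (l (a u v) (a v u)), fun z hzs hz0 => ⟨fun heven => ?_, ?_⟩⟩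
  · have hT : ∀ u v, ∃ T : W → W → ZMod 2, (∀ p q, T p q = T q p) ∧
        (∀ p q, T p q ≠ 0 → p ∈ B u ∧ q ∈ B u ∧ q ∈ nb p) ∧ {p | ∃ q, T p q ≠ 0}.Finite ∧
        (G.Adj u v → ∀ p, ∑ q ∈ nb p, T p q =
          (if p = a u v then 1 else 0) + (if p = r u then 1 else 0)) := by
      intro u v
      by_cases huv : G.Adj u v
      · obtain ⟨T, h1, h2, h3, h4⟩ := exists_join hnb (hconn u _ (ha u v huv).1)
        exact ⟨T, h1, fun p q h => by simpa using h2 p q h, h3, fun _ => h4⟩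
      · exact ⟨fun _ _ => 0, by simp, by simp, by simp, fun h => (huv h).elim⟩
    choose T hTs hTB hTf hTd using hT
    let D : V → V → W → W → ZMod 2 := fun u v p q => if p = a u v ∧ q = a v u then 1 else 0
    -- `J` lifts `z`: an edge becomes its chosen edge together with joins from its two ends to the
    -- roots. The joins correct the parity at the chosen ends, and at the root `r u` the parity is
    -- that of `z` at `u`. `J` vanishes on deleted edges, so its potential descends to the quotient.
    let J : W → W → ZMod 2 := fun p q => ∑ u, ∑ v, z u v * (D u v p q + T u v p q)
    have hne : ∀ p q, J p q ≠ 0 → ∃ u v, G.Adj u v ∧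
        ((p = a u v ∧ q = a v u) ∨ T u v p q ≠ 0) := by
      intro p q hJ
      obtain ⟨u, -, hu⟩ := Finset.exists_ne_zero_of_sum_ne_zero hJ
      obtain ⟨v, -, hv⟩ := Finset.exists_ne_zero_of_sum_ne_zero hu
      refine ⟨u, v, ?_, ?_⟩
      · by_contra h
        rw [hz0 u v h, zero_mul] at hv; exact hv rfl
      · by_contra! h
        apply hv
        simp [D, h.2]
        intro h1 h2
        exact (h.1 h1 h2).elim
    have hJs : ∀ p q, J p q = J q p := by
      intro p q
      simp only [J, mul_add, Finset.sum_add_distrib]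
      congr 1
      · rw [Finset.sum_comm]
        refine Finset.sum_congr rfl fun u _ => Finset.sum_congr rfl fun v _ => ?_
        rw [hzs]
        simp only [D, and_comm]
      · refine Finset.sum_congr rfl fun u _ => Finset.sum_congr rfl fun v _ => ?_
        rw [hTs]
    have hJn : ∀ p q, q ∉ nb p → J p q = 0 := by
      intro p q hq
      by_contra hJ
      obtain ⟨u, v, huv, ⟨rfl, rfl⟩ | h⟩ := hne p q hJ
      · exact hq (ha v u huv.symm).2
      · exact hq (hTB u v p q h).2.2
    have hJf : {p | ∃ q, J p q ≠ 0}.Finite := by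
      refine (Set.finite_iUnion (fun u => Set.finite_iUnion (fun v =>
        (Set.finite_singleton (a u v)).union (hTf u v)))).subset ?_
      rintro p ⟨q, hJ⟩
      obtain ⟨u, v, huv, h⟩ := hne p q hJ
      refine Set.mem_iUnion.2 ⟨u, Set.mem_iUnion.2 ⟨v, ?_⟩⟩
      exact h.imp (fun h => h.1) (fun h => ⟨q, h⟩)
    have hJe : ∀ p, ∑ q ∈ nb p, J p q = 0 := by
      intro p
      simp only [J]
      rw [Finset.sum_comm]
      refine Finset.sum_eq_zero fun u _ => ?_
      rw [Finset.sum_comm]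
      have : ∀ v, ∑ q ∈ nb p, z u v * (D u v p q + T u v p q) =
          z u v * (if p = r u then 1 else 0) := by
        intro v
        by_cases huv : G.Adj u v
        · rw [← Finset.mul_sum, Finset.sum_add_distrib, hTd u v huv]
          have : ∑ q ∈ nb p, D u v p q = if p = a u v then 1 else 0 := by
            simp only [D]
            by_cases h : p = a u v
            · subst h; simp [(ha v u huv.symm).2]
            · simp [h]
          rw [this, ← add_assoc, CharTwo.add_self_eq_zero, zero_add]
        · simp [hz0 u v huv]
      simp only [this]
      rw [← Finset.sum_mul, heven, zero_mul]
    obtain ⟨w, hw⟩ := hz J hJs hJn hJf hJe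
    refine ⟨Quot.lift w ?_, fun u v huv => ?_⟩
    · rintro f f' ⟨p, q, hpq, hB, hchosen, rfl, rfl⟩
      have h0 : J p q = 0 := by
        by_contra hJ
        obtain ⟨u, v, huv, h | h⟩ := hne p q hJ
        · exact hchosen u v huv h
        · exact hB u ⟨(hTB u v p q h).1, (hTB u v p q h).2.1⟩
      rw [hw p q hpq] at h0
      exact CharTwo.add_eq_zero.1 h0
    · change z u v = w (l (a u v) (a v u)) + w (l (a v u) (a u v))
      rw [← hw _ _ (ha v u huv.symm).2]
      have hT0 : ∀ u' v', T u' v' (a u v) (a v u) = 0 := by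
        intro u' v'
        by_contra h
        obtain ⟨h1, h2, -⟩ := hTB _ _ _ _ h
        exact huv.ne ((hdisj _ _ _ (ha u v huv).1 h1).trans
          (hdisj _ _ _ (ha v u huv.symm).1 h2).symm)
      have hD0 : ∀ u' v', ¬ (u' = u ∧ v' = v) → z u' v' * D u' v' (a u v) (a v u) = 0 := by
        intro u' v' hnot
        by_cases hadj : G.Adj u' v'
        · have : D u' v' (a u v) (a v u) = 0 := by
            simp only [D]
            rw [if_neg]
            rintro ⟨h1, h2⟩
            apply hnot
            constructor
            · exact hdisj _ _ _ (ha u' v' hadj).1 (h1 ▸ (ha u v huv).1)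
            · exact hdisj _ _ _ (ha v' u' hadj.symm).1 (h2 ▸ (ha v u huv.symm).1)
          rw [this, mul_zero]
        · rw [hz0 _ _ hadj, zero_mul]
      simp only [J, hT0, add_zero]
      rw [Finset.sum_eq_single u, Finset.sum_eq_single v]
      · simp [D]
      · intro v' _ hv'
        exact hD0 u v' (fun h => hv' h.2)
      · simp
      · intro u' _ hu'
        exact Finset.sum_eq_zero fun v' _ => hD0 u' v' (fun h => hu' h.1)
      · simp
  · rintro ⟨w, hw⟩ v
    -- Evenness is summed over the branch set of `v`. Inner edges cancel in pairs and deleted edges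
    -- have equal values on both sides, so only the chosen edges at `v` remain.
    let ζ : W → W → ZMod 2 := fun p q => w (Quot.mk R (l p q)) + w (Quot.mk R (l q p))
    have hζ : ∀ p q, ζ p q = ζ q p := fun p q => add_comm _ _
    have htot : ∑ p ∈ B v, ∑ q ∈ nb p, ζ p q = 0 :=
      Finset.sum_eq_zero fun p _ => hsum (fun f => w (Quot.mk R f)) p
    have hin : ∑ p ∈ B v, ∑ q ∈ (nb p).filter (fun q => q ∈ B v), ζ p q = 0 := by
      have := sum_sum_eq_zero_of_symm (B v) (fun p q => if q ∈ nb p then ζ p q else 0)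
        (fun p q => if_congr ⟨hnb p q, hnb q p⟩ (hζ p q) rfl) (fun p => if_neg (hirr p))
      rw [← this]
      refine Finset.sum_congr rfl fun p _ => ?_
      rw [← Finset.sum_filter]
      refine Finset.sum_congr ?_ fun _ _ => rfl
      ext q; simp [and_comm]
    have hout : ∑ p ∈ B v, ∑ q ∈ (nb p).filter (fun q => ¬ q ∈ B v), ζ p q = 0 := by
      simp only [← Finset.sum_filter_add_sum_filter_not (nb _) (fun q => q ∈ B v),
        Finset.sum_add_distrib, hin, zero_add] at htot
      exact htot
    rw [← hout, Finset.sum_sigma']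
    have hrestr : ∑ u, z v u = ∑ u ∈ Finset.univ.filter (G.Adj v), z v u := by
      symm
      refine Finset.sum_subset (Finset.subset_univ _) fun u _ hu => hz0 _ _ ?_
      simpa using hu
    rw [hrestr]
    refine Finset.sum_of_injOn (fun u => ⟨a v u, a u v⟩) ?_ ?_ ?_ ?_
    · intro u hu u' hu' h
      simp only [Finset.coe_filter, Finset.mem_univ, true_and, Set.mem_ofPred_eq] at hu hu'
      simp only [Sigma.mk.injEq, heq_eq_eq] at h
      exact hdisj _ _ _ (ha u v hu.symm).1 (h.2 ▸ (ha u' v hu'.symm).1)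
    · intro u hu
      simp only [Finset.coe_filter, Finset.mem_univ, true_and, Set.mem_ofPred_eq] at hu
      simp only [Finset.mem_coe, Finset.mem_sigma, Finset.mem_filter]
      exact ⟨(ha v u hu).1, (ha u v hu.symm).2,
        fun h => hu.ne (hdisj _ _ _ h (ha u v hu.symm).1)⟩
    · rintro ⟨p, q⟩ hpq hnot
      simp only [Finset.mem_sigma, Finset.mem_filter] at hpq
      obtain ⟨hp, hq, hqB⟩ := hpq
      have : Quot.mk R (l p q) = Quot.mk R (l q p) := by
        refine Quot.sound ⟨p, q, hq, fun v' h => ?_, fun u' v' hadj h => hnot ?_, rfl, rfl⟩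
        · exact hqB (hdisj _ _ _ h.1 hp ▸ h.2)
        · obtain ⟨rfl, rfl⟩ := h
          obtain rfl := hdisj _ _ _ (ha _ _ hadj).1 hp
          exact ⟨v', by simpa using hadj, rfl⟩
      simp only [ζ, this]
      exact CharTwo.add_self_eq_zero _
    · intro u hu
      exact hw v u (by simpa using hu)

end SimpleGraph

/-! ### The square grid and its cells. -/

/-- The neighbours in the square grid. -/
def gridNeighbors (p : ℤ × ℤ) : Finset (ℤ × ℤ) :=
  {(p.1 + 1, p.2), (p.1 - 1, p.2), (p.1, p.2 + 1), (p.1, p.2 - 1)}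

/-- The lower left corner of the unit cell to the left of a dart of the square grid. -/
def gridCell (p q : ℤ × ℤ) : ℤ × ℤ :=
  if q.1 = p.1 + 1 then p else if p.1 = q.1 + 1 then (q.1, q.2 - 1)
  else if q.2 = p.2 + 1 then (p.1 - 1, p.2) else q

lemma mem_gridNeighbors {p q : ℤ × ℤ} : q ∈ gridNeighbors p ↔
    q = (p.1 + 1, p.2) ∨ q = (p.1 - 1, p.2) ∨ q = (p.1, p.2 + 1) ∨ q = (p.1, p.2 - 1) := by
  simp [gridNeighbors]

lemma gridNeighbors_symm (p q : ℤ × ℤ) (h : q ∈ gridNeighbors p) : p ∈ gridNeighbors q := by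
  rw [mem_gridNeighbors] at h ⊢
  rcases h with rfl | rfl | rfl | rfl <;> simp

lemma gridNeighbors_irrefl (p : ℤ × ℤ) : p ∉ gridNeighbors p := by
  obtain ⟨i, j⟩ := p
  simp [mem_gridNeighbors]
  omega

lemma sum_gridNeighbors (p : ℤ × ℤ) (f : ℤ × ℤ → ZMod 2) : ∑ q ∈ gridNeighbors p, f q =
    f (p.1 + 1, p.2) + f (p.1 - 1, p.2) + f (p.1, p.2 + 1) + f (p.1, p.2 - 1) := by
  have h1 : p.1 + 1 ≠ p.1 - 1 := by omega
  have h2 : p.2 + 1 ≠ p.2 - 1 := by omega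
  rw [gridNeighbors, Finset.sum_insert, Finset.sum_insert, Finset.sum_insert,
    Finset.sum_singleton]
  · ring
  all_goals simp [h1, h2]

lemma gridCell_east (i j : ℤ) : gridCell (i, j) (i + 1, j) = (i, j) := by simp [gridCell]

lemma gridCell_west (i j : ℤ) : gridCell (i + 1, j) (i, j) = (i, j - 1) := by
  simp [gridCell]; omega

lemma gridCell_north (i j : ℤ) : gridCell (i, j) (i, j + 1) = (i - 1, j) := by
  simp [gridCell]

lemma gridCell_south (i j : ℤ) : gridCell (i, j + 1) (i, j) = (i, j) := by
  simp [gridCell]; omega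

/-- Each of the four cells around a vertex lies beside exactly two of the four edges there. -/
lemma gridCell_sum (w : ℤ × ℤ → ZMod 2) (p : ℤ × ℤ) :
    ∑ q ∈ gridNeighbors p, (w (gridCell p q) + w (gridCell q p)) = 0 := by
  obtain ⟨i, j⟩ := p
  have h1 := gridCell_west (i - 1) j
  have h2 := gridCell_east (i - 1) j
  have h3 := gridCell_north i (j - 1)
  have h4 := gridCell_south i (j - 1)
  rw [sub_add_cancel] at h1 h2 h3 h4
  rw [sum_gridNeighbors]
  simp only [gridCell_east, gridCell_west, gridCell_north, gridCell_south, h1, h2, h3, h4]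
  generalize w (i, j) = a
  generalize w (i, j - 1) = b
  generalize w (i - 1, j) = c
  generalize w (i - 1, j - 1) = d
  revert a b c d
  decide

/-- Finite even edge sets of the square grid are coboundaries of functions on the cells. -/
lemma grid_exists_coboundary (z : ℤ × ℤ → ℤ × ℤ → ZMod 2) (hs : ∀ p q, z p q = z q p)
    (hf : {p | ∃ q, z p q ≠ 0}.Finite) (he : ∀ p, ∑ q ∈ gridNeighbors p, z p q = 0) :
    ∃ w : ℤ × ℤ → ZMod 2, ∀ p, ∀ q ∈ gridNeighbors p,
      z p q = w (gridCell p q) + w (gridCell q p) := by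
  obtain ⟨M, hM⟩ : ∃ M : ℤ, ∀ p q, z p q ≠ 0 → p.2 ≤ M := by
    obtain ⟨M, hM⟩ := (hf.image Prod.snd).bddAbove
    exact ⟨M, fun p q h => hM ⟨p, ⟨q, h⟩, rfl⟩⟩
  have hM0 : ∀ i j q, M < j → z (i, j) q = 0 := by
    intro i j q hj
    by_contra h
    have := hM _ _ h
    simp only at this
    omega
  let h : ℤ → ℤ → ZMod 2 := fun i j => z (i, j) (i + 1, j)
  let k : ℤ → ℤ → ZMod 2 := fun i j => z (i, j) (i, j + 1)
  -- The parity of the edges of `z` crossed by a vertical ray going up from the cell, a finite sum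
  -- because `z` vanishes above height `M`. Horizontal edges then come out right at once; vertical
  -- ones follow by descending from above `M`, using evenness at each vertex.
  let w : ℤ × ℤ → ZMod 2 := fun p => ∑ t ∈ Finset.Ioc p.2 M, h p.1 t
  have hw_gt : ∀ i j, M ≤ j → w (i, j) = 0 := by
    intro i j hj
    simp only [w]
    rw [Finset.Ioc_eq_empty (by simpa using hj), Finset.sum_empty]
  have hhor : ∀ i j, h i j = w (i, j) + w (i, j - 1) := by
    intro i j
    by_cases hj : j ≤ M
    · have : Finset.Ioc (j - 1) M = insert j (Finset.Ioc j M) := by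
        ext t; simp only [Finset.mem_Ioc, Finset.mem_insert]; omega
      simp only [w]
      rw [this, Finset.sum_insert (by simp)]
      generalize ∑ t ∈ Finset.Ioc j M, h i t = a
      generalize h i j = b
      revert a b; decide
    · rw [hw_gt i j (by omega), hw_gt i (j - 1) (by omega)]
      exact hM0 _ _ _ (by omega)
  have hcross : ∀ i j, h i j + h (i - 1) j = k i j + k i (j - 1) := by
    intro i j
    have := he (i, j)
    rw [sum_gridNeighbors] at this
    simp only at this
    rw [hs (i, j) (i - 1, j), hs (i, j) (i, j - 1)] at this
    simp only [h, k, sub_add_cancel]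
    revert this
    generalize z (i, j) (i + 1, j) = a
    generalize z (i - 1, j) (i, j) = b
    generalize z (i, j) (i, j + 1) = c
    generalize z (i, j - 1) (i, j) = d
    revert a b c d; decide
  have hver : ∀ i j, k i j = w (i, j) + w (i - 1, j) := by
    intro i
    have base : ∀ j, M < j → k i j = w (i, j) + w (i - 1, j) := by
      intro j hj
      rw [hw_gt _ _ hj.le, hw_gt _ _ hj.le]
      exact hM0 _ _ _ hj
    have step : ∀ n : ℕ, ∀ j, M < j + n → k i j = w (i, j) + w (i - 1, j) := by
      intro n
      induction n with
      | zero => intro j hj; exact base j (by simpa using hj)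
      | succ n ih =>
        intro j hj
        have h1 := ih (j + 1) (by push_cast at hj; omega)
        have h2 := hcross i (j + 1)
        rw [hhor, hhor, h1] at h2
        rw [add_sub_cancel_right] at h2
        revert h2
        generalize w (i, j + 1) = a
        generalize w (i - 1, j + 1) = b
        generalize w (i, j) = c
        generalize w (i - 1, j) = d
        generalize k i j = e
        revert a b c d e; decide
    intro j
    exact step (M - j + 1).toNat j (by omega)
  refine ⟨w, ?_⟩
  rintro ⟨i, j⟩ q hq
  rw [mem_gridNeighbors] at hq
  rcases hq with rfl | rfl | rfl | rfl
  · rw [gridCell_east, gridCell_west]; exact hhor i j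
  · have h1 := gridCell_west (i - 1) j
    have h2 := gridCell_east (i - 1) j
    rw [sub_add_cancel] at h1 h2
    simp only
    rw [h1, h2, hs, add_comm]
    have := hhor (i - 1) j
    simp only [h, sub_add_cancel] at this
    exact this
  · rw [gridCell_north, gridCell_south]; exact (hver i j).trans (add_comm _ _)
  · have h3 := gridCell_north i (j - 1)
    have h4 := gridCell_south i (j - 1)
    rw [sub_add_cancel] at h3 h4
    simp only
    rw [h3, h4, hs]
    have := hver i (j - 1)
    simp only [k, sub_add_cancel] at this
    exact this

/-- Finite minors of the square grid have abstract duals. -/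
lemma SimpleGraph.hasDual_of_grid_minor {V : Type} [Fintype V] {G : SimpleGraph V}
    (B : V → Finset (ℤ × ℤ)) (hdisj : ∀ u v p, p ∈ B u → p ∈ B v → u = v) (r : V → ℤ × ℤ)
    (hconn : ∀ u, ∀ p ∈ B u, Relation.ReflTransGen
      (fun p q => p ∈ B u ∧ q ∈ B u ∧ q ∈ gridNeighbors p) p (r u))
    (a : V → V → ℤ × ℤ)
    (ha : ∀ u v, G.Adj u v → a u v ∈ B u ∧ a u v ∈ gridNeighbors (a v u)) : G.HasDual := by
  obtain ⟨F, l, hl⟩ := exists_isDual_of_minor gridNeighbors_symm gridNeighbors_irrefl gridCell_sum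
    (fun z hs _ hf he => grid_exists_coboundary z hs hf he) B hdisj r hconn a ha
  exact hl.hasDual

/-! ### From plane drawings to grid minors. -/

lemma gridNeighbors_reflTransGen_symm {S : Set (ℤ × ℤ)} {p q : ℤ × ℤ}
    (h : ReflTransGen (fun p q => p ∈ S ∧ q ∈ S ∧ q ∈ gridNeighbors p) p q) :
    ReflTransGen (fun p q => p ∈ S ∧ q ∈ S ∧ q ∈ gridNeighbors p) q p := by
  induction h with
  | refl => exact .refl
  | tail _ h ih => exact .head ⟨h.2.1, h.1, gridNeighbors_symm _ _ h.2.2⟩ ih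

/-- The part of a path before it first enters `A`. -/
lemma exists_first_entry {W : Type*} {N A : Set W} {nb : W → Finset W} {p q : W}
    (h : ReflTransGen (fun p q => p ∈ N ∧ q ∈ N ∧ q ∈ nb p) p q) (hp : p ∉ A) (hq : q ∈ A) :
    ∃ x y, ReflTransGen (fun p q => p ∈ N \ A ∧ q ∈ N \ A ∧ q ∈ nb p) p x ∧ y ∈ A ∧ y ∈ nb x := by
  have key : (q ∉ A ∧ ReflTransGen (fun p q => p ∈ N \ A ∧ q ∈ N \ A ∧ q ∈ nb p) p q) ∨
      ∃ x y, ReflTransGen (fun p q => p ∈ N \ A ∧ q ∈ N \ A ∧ q ∈ nb p) p x ∧ y ∈ A ∧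
        y ∈ nb x := by
    clear hq
    induction h with
    | refl => exact Or.inl ⟨hp, .refl⟩
    | @tail b c _ hbc ih =>
      rcases ih with ⟨hb, ih⟩ | ih
      · by_cases hc : c ∈ A
        · exact Or.inr ⟨b, c, ih, hc, hbc.2.2⟩
        · exact Or.inl ⟨hc, ih.tail ⟨⟨hbc.1, hb⟩, ⟨hbc.2.1, hc⟩, hbc.2.2⟩⟩
      · exact Or.inr ih
  rcases key with h | h
  · exact (h.1 hq).elim
  · exact h

/-- A graph has an abstract dual if its vertices and edges can be represented by connected finite
sets of grid points which meet only for incident pairs. -/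
lemma SimpleGraph.hasDual_of_grid_sets {V : Type} [Fintype V] [LinearOrder V] {G : SimpleGraph V}
    (A : V → Set (ℤ × ℤ)) (N : V → V → Set (ℤ × ℤ)) (hAf : ∀ u, (A u).Finite)
    (hNf : ∀ u v, G.Adj u v → u < v → (N u v).Finite) (hAne : ∀ u, (A u).Nonempty)
    (hAc : ∀ u, ∀ p ∈ A u, ∀ q ∈ A u,
      ReflTransGen (fun p q => p ∈ A u ∧ q ∈ A u ∧ q ∈ gridNeighbors p) p q)
    (hNc : ∀ u v, G.Adj u v → u < v → ∀ p ∈ N u v, ∀ q ∈ N u v,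
      ReflTransGen (fun p q => p ∈ N u v ∧ q ∈ N u v ∧ q ∈ gridNeighbors p) p q)
    (hAA : ∀ u v, u ≠ v → Disjoint (A u) (A v))
    (hNA : ∀ u v w, G.Adj u v → u < v → w ≠ u → w ≠ v → Disjoint (N u v) (A w))
    (hNN : ∀ u v x y, G.Adj u v → u < v → G.Adj x y → x < y → (u ≠ x ∨ v ≠ y) →
      Disjoint (N u v) (N x y))
    (hl : ∀ u v, G.Adj u v → u < v → (A u ∩ N u v).Nonempty)
    (hr : ∀ u v, G.Adj u v → u < v → (A v ∩ N u v).Nonempty) : G.HasDual := by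
  classical
  have hex : ∀ u v, ∃ s x y, (G.Adj u v ∧ u < v) → s ∈ A u ∧ s ∈ N u v \ A v ∧ y ∈ A v ∧
      y ∈ gridNeighbors x ∧
      ReflTransGen (fun p q => p ∈ N u v \ A v ∧ q ∈ N u v \ A v ∧ q ∈ gridNeighbors p) s x := by
    intro u v
    by_cases h : G.Adj u v ∧ u < v
    · obtain ⟨s, hsA, hsN⟩ := hl u v h.1 h.2
      obtain ⟨t, htA, htN⟩ := hr u v h.1 h.2
      have hs : s ∉ A v := Set.disjoint_left.1 (hAA u v h.2.ne) hsA
      obtain ⟨x, y, hx, hy, hxy⟩ := exists_first_entry (hNc u v h.1 h.2 s hsN t htN) hs htA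
      exact ⟨s, x, y, fun _ => ⟨hsA, ⟨hsN, hs⟩, hy, hxy, hx⟩⟩
    · exact ⟨0, 0, 0, fun h' => (h h').elim⟩
  choose s x y hsxy using hex
  choose r hr' using hAne
  -- The smaller end `u` absorbs the part of `N u v` that is reachable from `s u v` without entering
  -- `A v`. The step from `x u v` into `A v` then represents the edge.
  let P : V → V → Set (ℤ × ℤ) := fun u v => {p | (G.Adj u v ∧ u < v) ∧
    ReflTransGen (fun p q => p ∈ N u v \ A v ∧ q ∈ N u v \ A v ∧ q ∈ gridNeighbors p) (s u v) p}
  have hPN : ∀ u v p, p ∈ P u v → p ∈ N u v \ A v := by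
    rintro u v p ⟨h, hp⟩
    cases hp with
    | refl => exact (hsxy u v h).2.1
    | tail _ h => exact h.2.1
  let BS : V → Set (ℤ × ℤ) := fun u => A u ∪ ⋃ v, P u v
  have hBf : ∀ u, (BS u).Finite := by
    intro u
    refine (hAf u).union (Set.finite_iUnion fun v => ?_)
    by_cases h : G.Adj u v ∧ u < v
    · exact (hNf u v h.1 h.2).subset fun p hp => (hPN u v p hp).1
    · refine Set.finite_empty.subset fun p hp => (h hp.1).elim
  refine SimpleGraph.hasDual_of_grid_minor (fun u => (hBf u).toFinset) ?_ r ?_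
    (fun u v => if u < v then x u v else y v u) ?_
  · intro u v p hpu hpv
    by_contra huv
    rw [Set.Finite.mem_toFinset] at hpu hpv
    have hAP : ∀ u v, u ≠ v → p ∈ A u → ∀ w, p ∉ P v w := by
      intro u v huv hpA w hp
      have hN := hPN _ _ _ hp
      by_cases hw : u = w
      · subst hw; exact hN.2 hpA
      · exact Set.disjoint_left.1 (hNA v w u hp.1.1 hp.1.2 huv hw) hN.1 hpA
    rcases hpu with hu | hu <;> rcases hpv with hv | hv
    · exact Set.disjoint_left.1 (hAA u v huv) hu hv
    · obtain ⟨w, hw⟩ := Set.mem_iUnion.1 hv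
      exact hAP u v huv hu w hw
    · obtain ⟨w, hw⟩ := Set.mem_iUnion.1 hu
      exact hAP v u (Ne.symm huv) hv w hw
    · obtain ⟨w, hw⟩ := Set.mem_iUnion.1 hu
      obtain ⟨w', hw'⟩ := Set.mem_iUnion.1 hv
      exact Set.disjoint_left.1 (hNN u w v w' hw.1.1 hw.1.2 hw'.1.1 hw'.1.2 (Or.inl huv))
        (hPN _ _ _ hw).1 (hPN _ _ _ hw').1
  · intro u p hp
    simp only [Set.Finite.mem_toFinset] at hp ⊢
    have hAr : ∀ p ∈ A u, ReflTransGen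
        (fun p q => p ∈ BS u ∧ q ∈ BS u ∧ q ∈ gridNeighbors p) p (r u) := by
      intro p hp
      exact ReflTransGen.mono (fun a b h => ⟨Or.inl h.1, Or.inl h.2.1, h.2.2⟩) _ _
        (hAc u p hp _ (hr' u))
    rcases hp with hp | hp
    · exact hAr p hp
    · obtain ⟨v, huv, hp⟩ := Set.mem_iUnion.1 hp
      refine ReflTransGen.trans ?_ (hAr (s u v) (hsxy u v huv).1)
      induction hp with
      | refl => exact .refl
      | @tail b c hb hbc ih =>
        exact .head ⟨Or.inr (Set.mem_iUnion.2 ⟨v, huv, hb.tail hbc⟩),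
          Or.inr (Set.mem_iUnion.2 ⟨v, huv, hb⟩), gridNeighbors_symm _ _ hbc.2.2⟩
          (ih (Set.mem_iUnion.2 ⟨v, huv, hb⟩))
  · intro u v huv
    rw [Set.Finite.mem_toFinset]
    rcases lt_or_gt_of_ne huv.ne with h | h
    · have := hsxy u v ⟨huv, h⟩
      simp only [h, h.not_gt, if_true, if_false]
      exact ⟨Or.inr (Set.mem_iUnion.2 ⟨v, ⟨huv, h⟩, this.2.2.2.2⟩),
        gridNeighbors_symm _ _ this.2.2.2.1⟩
    · have := hsxy v u ⟨huv.symm, h⟩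
      simp only [h, h.not_gt, if_true, if_false]
      exact ⟨Or.inl this.2.2.1, this.2.2.2.1⟩

/-- The grid points near the dilation of `X` by `K`. -/
def gridHull (K : ℝ) (X : Set (EuclideanSpace ℝ (Fin 2))) : Set (ℤ × ℤ) :=
  {p | ∃ x ∈ X, |p.1 - K * x 0| ≤ 1 ∧ |p.2 - K * x 1| ≤ 1}

lemma gridHull_nonempty (K : ℝ) {X : Set (EuclideanSpace ℝ (Fin 2))} (h : X.Nonempty) :
    (gridHull K X).Nonempty := by
  obtain ⟨x, hx⟩ := h
  refine ⟨(round (K * x 0), round (K * x 1)), x, hx, ?_, ?_⟩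
  · rw [abs_sub_comm]; exact (abs_sub_round _).trans (by norm_num)
  · rw [abs_sub_comm]; exact (abs_sub_round _).trans (by norm_num)

lemma gridHull_mono (K : ℝ) {X Y : Set (EuclideanSpace ℝ (Fin 2))} (h : X ⊆ Y) :
    gridHull K X ⊆ gridHull K Y := by
  rintro p ⟨x, hx, hp⟩; exact ⟨x, h hx, hp⟩

lemma grid_path_horizontal {S : Set (ℤ × ℤ)} {j i i' : ℤ} (h : i ≤ i')
    (hS : ∀ t, i ≤ t → t ≤ i' → (t, j) ∈ S) :
    ReflTransGen (fun p q => p ∈ S ∧ q ∈ S ∧ q ∈ gridNeighbors p) (i, j) (i', j) := by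
  induction i', h using Int.leInduction with
  | base => exact .refl
  | succ n hn ih =>
    exact (ih fun t h1 h2 => hS t h1 (by omega)).tail
      ⟨hS n hn (by omega), hS (n + 1) (by omega) le_rfl, by simp [mem_gridNeighbors]⟩

lemma grid_path_vertical {S : Set (ℤ × ℤ)} {j i i' : ℤ} (h : i ≤ i')
    (hS : ∀ t, i ≤ t → t ≤ i' → (j, t) ∈ S) :
    ReflTransGen (fun p q => p ∈ S ∧ q ∈ S ∧ q ∈ gridNeighbors p) (j, i) (j, i') := by
  induction i', h using Int.leInduction with
  | base => exact .refl
  | succ n hn ih =>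
    exact (ih fun t h1 h2 => hS t h1 (by omega)).tail
      ⟨hS n hn (by omega), hS (n + 1) (by omega) le_rfl, by simp [mem_gridNeighbors]⟩

lemma grid_path_box {S : Set (ℤ × ℤ)} {a b : ℝ}
    (hS : ∀ p : ℤ × ℤ, |p.1 - a| ≤ 1 → |p.2 - b| ≤ 1 → p ∈ S) {p q : ℤ × ℤ}
    (hp1 : |p.1 - a| ≤ 1) (hp2 : |p.2 - b| ≤ 1) (hq1 : |q.1 - a| ≤ 1) (hq2 : |q.2 - b| ≤ 1) :
    ReflTransGen (fun p q => p ∈ S ∧ q ∈ S ∧ q ∈ gridNeighbors p) p q := by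
  have conv : ∀ (c : ℝ) (m n t : ℤ), |m - c| ≤ 1 → |n - c| ≤ 1 → m ≤ t → t ≤ n →
      |t - c| ≤ 1 := by
    intro c m n t hm hn h1 h2
    rw [abs_le] at hm hn ⊢
    have h1 : (m : ℝ) ≤ t := by exact_mod_cast h1
    have h2 : (t : ℝ) ≤ n := by exact_mod_cast h2
    constructor <;> linarith [hm.1, hn.2]
  obtain ⟨i, j⟩ := p
  obtain ⟨i', j'⟩ := q
  simp only at hp1 hp2 hq1 hq2
  refine ReflTransGen.trans (b := (i', j)) ?_ ?_
  · rcases le_total i i' with h | h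
    · exact grid_path_horizontal h fun t h1 h2 => hS _ (conv _ _ _ t hp1 hq1 h1 h2) hp2
    · exact gridNeighbors_reflTransGen_symm (grid_path_horizontal h fun t h1 h2 =>
        hS _ (conv _ _ _ t hq1 hp1 h1 h2) hp2)
  · rcases le_total j j' with h | h
    · exact grid_path_vertical h fun t h1 h2 => hS _ hq1 (conv _ _ _ t hp2 hq2 h1 h2)
    · exact gridNeighbors_reflTransGen_symm (grid_path_vertical h fun t h1 h2 =>
        hS _ hq1 (conv _ _ _ t hq2 hp2 h1 h2))

/-- A rounding error of at most one half and a displacement below one half together stay within one,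
so nearby points of `X` round into a common box. Preconnectedness chains these local connections. -/
lemma gridHull_connected (K : ℝ) {X : Set (EuclideanSpace ℝ (Fin 2))} (hX : IsPreconnected X)
    {p q : ℤ × ℤ} (hp : p ∈ gridHull K X) (hq : q ∈ gridHull K X) :
    ReflTransGen (fun p q => p ∈ gridHull K X ∧ q ∈ gridHull K X ∧ q ∈ gridNeighbors p) p q := by
  let ρ : EuclideanSpace ℝ (Fin 2) → ℤ × ℤ := fun x => (round (K * x 0), round (K * x 1))
  have hbox : ∀ x ∈ X, ∀ p : ℤ × ℤ, |p.1 - K * x 0| ≤ 1 → |p.2 - K * x 1| ≤ 1 →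
      p ∈ gridHull K X := fun x hx p h1 h2 => ⟨x, hx, h1, h2⟩
  have hround : ∀ c : ℝ, |(round c : ℝ) - c| ≤ 1 / 2 := fun c => by
    rw [abs_sub_comm]; exact abs_sub_round _
  have hround1 : ∀ c : ℝ, |(round c : ℝ) - c| ≤ 1 := fun c => (hround c).trans (by norm_num)
  have hnear : ∀ x ∈ X, ∀ y ∈ X, ReflTransGen
      (fun p q => p ∈ gridHull K X ∧ q ∈ gridHull K X ∧ q ∈ gridNeighbors p) (ρ x) (ρ y) := by
    intro x hx y hy
    refine hX.induction₂ (fun x y => ReflTransGen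
      (fun p q => p ∈ gridHull K X ∧ q ∈ gridHull K X ∧ q ∈ gridNeighbors p) (ρ x) (ρ y))
      (fun x hx => ?_) (fun _ _ _ _ _ _ h1 h2 => h1.trans h2)
      (fun _ _ _ _ h => gridNeighbors_reflTransGen_symm h) hx hy
    have hc : ∀ i : Fin 2, ∀ᶠ y in nhdsWithin x X, |K * y i - K * x i| < 1 / 2 := by
      intro i
      have hcont : Continuous fun y : EuclideanSpace ℝ (Fin 2) => |K * y i - K * x i| := by
        fun_prop
      apply nhdsWithin_le_nhds
      have := hcont.tendsto x
      simp only [sub_self, abs_zero] at this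
      exact this.eventually (gt_mem_nhds (by norm_num))
    filter_upwards [hc 0, hc 1] with y h0 h1
    have tri : ∀ c d : ℝ, |d - c| < 1 / 2 → |(round d : ℝ) - c| ≤ 1 := by
      intro c d hcd
      have h1 := hround d
      rw [abs_le] at h1 ⊢
      rw [abs_lt] at hcd
      constructor <;> linarith [h1.1, h1.2, hcd.1, hcd.2]
    exact grid_path_box (hbox x hx) (hround1 _) (hround1 _) (tri _ _ h0) (tri _ _ h1)
  obtain ⟨x, hx, hp1, hp2⟩ := hp
  obtain ⟨y, hy, hq1, hq2⟩ := hq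
  exact ((grid_path_box (hbox x hx) hp1 hp2 (hround1 _) (hround1 _)).trans
    (hnear x hx y hy)).trans (grid_path_box (hbox y hy) (hround1 _) (hround1 _) hq1 hq2)

lemma gridHull_finite (K : ℝ) {X : Set (EuclideanSpace ℝ (Fin 2))} (hX : IsCompact X) :
    (gridHull K X).Finite := by
  obtain ⟨C, hC⟩ := hX.isBounded.exists_norm_le
  refine ((Set.finite_Icc (-⌈|K| * C + 1⌉) ⌈|K| * C + 1⌉).prod
    (Set.finite_Icc (-⌈|K| * C + 1⌉) ⌈|K| * C + 1⌉)).subset ?_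
  rintro p ⟨x, hx, h1, h2⟩
  have key : ∀ (m : ℤ) (i : Fin 2), |m - K * x i| ≤ 1 →
      m ∈ Set.Icc (-⌈|K| * C + 1⌉) ⌈|K| * C + 1⌉ := by
    intro m i h
    have e1 : |x i| ≤ C := (PiLp.norm_apply_le x i).trans (hC x hx)
    have e2 : |K * x i| ≤ |K| * C := by
      rw [abs_mul]; exact mul_le_mul_of_nonneg_left e1 (abs_nonneg _)
    have e3 := Int.le_ceil (|K| * C + 1)
    rw [abs_le] at h e2
    constructor
    · have : (-⌈|K| * C + 1⌉ : ℝ) ≤ m := by linarith [h.1, e2.1]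
      exact_mod_cast this
    · have : (m : ℝ) ≤ ⌈|K| * C + 1⌉ := by linarith [h.2, e2.2]
      exact_mod_cast this
  exact ⟨key _ 0 h1, key _ 1 h2⟩

-- Disjoint compact sets are a positive distance apart, and dilation enlarges this beyond the reach
-- of two boxes around a common grid point.
open Filter in
lemma eventually_disjoint_gridHull {X Y : Set (EuclideanSpace ℝ (Fin 2))} (hX : IsCompact X)
    (hY : IsCompact Y) (h : Disjoint X Y) :
    ∀ᶠ K : ℝ in atTop, Disjoint (gridHull K X) (gridHull K Y) := by
  obtain ⟨δ, hδ, hd⟩ := h.exists_thickenings hX hY.isClosed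
  -- A common grid point bounds each coordinate difference of `x` and `y` by 2 / K, which is less
  -- than δ / 2, so that the Euclidean distance stays below δ.
  filter_upwards [eventually_gt_atTop (4 / δ), eventually_gt_atTop 0] with K hK hK0
  rw [Set.disjoint_left]
  rintro p ⟨x, hx, hx0, hx1⟩ ⟨y, hy, hy0, hy1⟩
  have hdist : dist x y < δ := by
    have hK' : 4 < K * δ := by rwa [div_lt_iff₀ hδ] at hK
    have key : ∀ (m : ℤ) (i : Fin 2), |m - K * x i| ≤ 1 → |m - K * y i| ≤ 1 →
        dist (x i) (y i) ≤ δ / 2 := by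
      intro m i h1 h2
      rw [abs_le] at h1 h2
      rw [Real.dist_eq, abs_le]
      constructor
      · by_contra! hlt
        nlinarith [mul_lt_mul_of_pos_left hlt hK0]
      · by_contra! hlt
        nlinarith [mul_lt_mul_of_pos_left hlt hK0]
    have k0 := key _ 0 hx0 hy0
    have k1 := key _ 1 hx1 hy1
    rw [EuclideanSpace.dist_eq, Fin.sum_univ_two, Real.sqrt_lt' hδ]
    have n0 : 0 ≤ dist (x 0) (y 0) := dist_nonneg
    have n1 : 0 ≤ dist (x 1) (y 1) := dist_nonneg
    nlinarith [mul_self_le_mul_self n0 k0, mul_self_le_mul_self n1 k1]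
  refine Set.disjoint_left.1 hd (Metric.self_subset_thickening hδ _ hx) ?_
  exact Metric.mem_thickening_iff.2 ⟨y, hy, hdist⟩

/-- The extension to the line of a parametrization of an arc. -/
lemma IsPlaneArc.exists_param {p q : EuclideanSpace ℝ (Fin 2)} {A : Set (EuclideanSpace ℝ (Fin 2))}
    (h : IsPlaneArc p q A) : ∃ c : ℝ → EuclideanSpace ℝ (Fin 2), Continuous c ∧
      Set.InjOn c (Set.Icc 0 1) ∧ c 0 = p ∧ c 1 = q ∧ ∀ t ∈ Set.Icc (0 : ℝ) 1, c t ∈ A := by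
  obtain ⟨γ, hγ, rfl⟩ := h
  refine ⟨γ.extend, γ.continuous_extend, fun s hs t ht hst => ?_, γ.extend_zero, γ.extend_one,
    fun t ht => ⟨⟨t, ht⟩, (γ.extend_apply ht).symm⟩⟩
  rw [γ.extend_apply hs, γ.extend_apply ht] at hst
  exact congrArg Subtype.val (hγ hst)

/-- Stars are pairwise disjoint, middle thirds are pairwise disjoint, and a middle third meets only
the stars of its two ends. These are finitely many disjoint pairs of compact sets, so one scale `K`
keeps all their grid hulls disjoint. -/
lemma PlaneEmbedding.hasDual {V : Type} [Fintype V] [LinearOrder V] {G : SimpleGraph V}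
    (E : PlaneEmbedding G) : G.HasDual := by
  classical
  have hex : ∀ u v, ∃ c : ℝ → EuclideanSpace ℝ (Fin 2), G.Adj u v → Continuous c ∧
      Set.InjOn c (Set.Icc 0 1) ∧ c 0 = E.point u ∧ c 1 = E.point v ∧
      ∀ t ∈ Set.Icc (0 : ℝ) 1, c t ∈ E.arc s(u, v) := by
    intro u v
    by_cases h : G.Adj u v
    · obtain ⟨c, hc⟩ := (E.isPlaneArc u v h).exists_param
      exact ⟨c, fun _ => hc⟩
    · exact ⟨fun _ => 0, fun h' => (h h').elim⟩
  choose c hc using hex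
  -- The chosen curves `c u v` and `c v u` are unrelated. Always using the one that starts at the
  -- smaller end makes both tails and the middle of an edge parts of one injective curve.
  let tail : V → V → Set (EuclideanSpace ℝ (Fin 2)) := fun u v =>
    if u < v then c u v '' Set.Icc 0 (1 / 3) else c v u '' Set.Icc (2 / 3) 1
  let mid : V → V → Set (EuclideanSpace ℝ (Fin 2)) := fun u v => c u v '' Set.Icc (1 / 3) (2 / 3)
  have i1 : Set.Icc (0 : ℝ) (1 / 3) ⊆ Set.Icc 0 1 := Set.Icc_subset_Icc le_rfl (by norm_num)
  have i2 : Set.Icc (1 / 3 : ℝ) (2 / 3) ⊆ Set.Icc 0 1 :=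
    Set.Icc_subset_Icc (by norm_num) (by norm_num)
  have i3 : Set.Icc (2 / 3 : ℝ) 1 ⊆ Set.Icc 0 1 := Set.Icc_subset_Icc (by norm_num) le_rfl
  have h0 : (0 : ℝ) ∈ Set.Icc (0 : ℝ) 1 := by simp
  have h1 : (1 : ℝ) ∈ Set.Icc (0 : ℝ) 1 := by simp
  have tail_sub : ∀ u v, G.Adj u v → tail u v ⊆ E.arc s(u, v) := by
    intro u v huv x hx
    simp only [tail] at hx
    split_ifs at hx
    · obtain ⟨t, ht, rfl⟩ := hx
      exact (hc u v huv).2.2.2.2 t (i1 ht)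
    · obtain ⟨t, ht, rfl⟩ := hx
      rw [Sym2.eq_swap]
      exact (hc v u huv.symm).2.2.2.2 t (i3 ht)
  have mid_sub : ∀ u v, G.Adj u v → mid u v ⊆ E.arc s(u, v) := by
    rintro u v huv _ ⟨t, ht, rfl⟩
    exact (hc u v huv).2.2.2.2 t (i2 ht)
  have tail_point : ∀ u v w, G.Adj u v → E.point w ∈ tail u v → w = u := by
    intro u v w huv hw
    have hmem := E.mem_of_point_mem_arc s(u, v) huv w (tail_sub u v huv hw)
    rw [Sym2.mem_iff] at hmem
    rcases hmem with rfl | rfl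
    · rfl
    · exfalso
      simp only [tail] at hw
      split_ifs at hw
      · obtain ⟨t, ht, hwt⟩ := hw
        have := hc u w huv
        rw [← this.2.2.2.1] at hwt
        have := this.2.1 (i1 ht) h1 hwt
        subst this
        norm_num at ht
      · obtain ⟨t, ht, hwt⟩ := hw
        have := hc w u huv.symm
        rw [← this.2.2.1] at hwt
        have := this.2.1 (i3 ht) h0 hwt
        subst this
        norm_num at ht
  have mid_point : ∀ u v w, G.Adj u v → E.point w ∉ mid u v := by
    intro u v w huv hw
    have hmem := E.mem_of_point_mem_arc s(u, v) huv w (mid_sub u v huv hw)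
    rw [Sym2.mem_iff] at hmem
    obtain ⟨t, ht, hwt⟩ := hw
    have hcuv := hc u v huv
    rcases hmem with rfl | rfl
    · rw [← hcuv.2.2.1] at hwt
      have := hcuv.2.1 (i2 ht) h0 hwt
      subst this
      norm_num at ht
    · rw [← hcuv.2.2.2.1] at hwt
      have := hcuv.2.1 (i2 ht) h1 hwt
      subst this
      norm_num at ht
  have tail_disj : ∀ u v, G.Adj u v → u < v → Disjoint (tail u v) (tail v u) := by
    intro u v huv hlt
    simp only [tail, hlt, hlt.not_gt, if_true, if_false]
    rw [Set.disjoint_left]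
    rintro _ ⟨t, ht, rfl⟩ ⟨t', ht', htt⟩
    have := (hc u v huv).2.1 (i3 ht') (i1 ht) htt
    subst this
    have := ht.2
    have := ht'.1
    linarith
  have tail_disj' : ∀ u v, G.Adj u v → Disjoint (tail u v) (tail v u) := by
    intro u v huv
    rcases lt_or_gt_of_ne huv.ne with h | h
    · exact tail_disj u v huv h
    · exact (tail_disj v u huv.symm h).symm
  have tail_compact : ∀ u v, G.Adj u v → IsCompact (tail u v) := by
    intro u v huv
    simp only [tail]
    split_ifs
    · exact isCompact_Icc.image (hc u v huv).1
    · exact isCompact_Icc.image (hc v u huv.symm).1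
  have tail_conn : ∀ u v, G.Adj u v → IsPreconnected (tail u v) := by
    intro u v huv
    simp only [tail]
    split_ifs
    · exact isPreconnected_Icc.image _ (hc u v huv).1.continuousOn
    · exact isPreconnected_Icc.image _ (hc v u huv.symm).1.continuousOn
  have point_mem_tail : ∀ u v, G.Adj u v → E.point u ∈ tail u v := by
    intro u v huv
    simp only [tail]
    split_ifs
    · exact ⟨0, by norm_num, (hc u v huv).2.2.1⟩
    · exact ⟨1, by norm_num, (hc v u huv.symm).2.2.2.1⟩
  let star : V → Set (EuclideanSpace ℝ (Fin 2)) := fun u =>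
    ⋃ v, ({E.point u} ∪ if G.Adj u v then tail u v else ∅)
  have mem_star : ∀ u x, x ∈ star u ↔ x = E.point u ∨ ∃ v, G.Adj u v ∧ x ∈ tail u v := by
    intro u x
    simp only [star, Set.mem_iUnion, Set.mem_union, Set.mem_singleton_iff]
    constructor
    · rintro ⟨v, h | h⟩
      · exact Or.inl h
      · split_ifs at h with huv
        · exact Or.inr ⟨v, huv, h⟩
        · exact h.elim
    · rintro (h | ⟨v, huv, h⟩)
      · exact ⟨u, Or.inl h⟩
      · exact ⟨v, Or.inr (by rwa [if_pos huv])⟩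
  have star_compact : ∀ u, IsCompact (star u) := by
    intro u
    refine isCompact_iUnion fun v => isCompact_singleton.union ?_
    split_ifs with h
    · exact tail_compact u v h
    · exact isCompact_empty
  have star_conn : ∀ u, IsPreconnected (star u) := by
    intro u
    refine isPreconnected_iUnion ⟨E.point u, Set.mem_iInter.2 fun v => Or.inl rfl⟩ fun v => ?_
    split_ifs with h
    · refine IsPreconnected.union (E.point u) rfl (point_mem_tail u v h)
        isPreconnected_singleton (tail_conn u v h)
    · rw [Set.union_empty]; exact isPreconnected_singleton
  have tail_sub_star : ∀ u v, G.Adj u v → tail u v ⊆ star u :=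
    fun u v h x hx => (mem_star u x).2 (Or.inr ⟨v, h, hx⟩)
  have mid_compact : ∀ u v, G.Adj u v → IsCompact (mid u v) := fun u v h =>
    isCompact_Icc.image (hc u v h).1
  have mid_conn : ∀ u v, G.Adj u v → IsPreconnected (mid u v) := fun u v h =>
    isPreconnected_Icc.image _ (hc u v h).1.continuousOn
  have star_star : ∀ u v, u ≠ v → Disjoint (star u) (star v) := by
    intro u v huv
    rw [Set.disjoint_left]
    intro x hxu hxv
    rw [mem_star] at hxu hxv
    rcases hxu with rfl | ⟨w, hw, hxu⟩
    · rcases hxv with h | ⟨w, hw, hxv⟩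
      · exact huv (E.point_injective h)
      · exact huv (tail_point v w u hw hxv)
    · rcases hxv with rfl | ⟨w', hw', hxv⟩
      · exact huv (tail_point u w v hw hxu).symm
      · by_cases he : s(u, w) = s(v, w')
        · rw [Sym2.eq_iff] at he
          rcases he with he | ⟨rfl, rfl⟩
          · exact huv he.1
          · exact Set.disjoint_left.1 (tail_disj' u w hw) hxu hxv
        · obtain ⟨y, -, -, rfl⟩ := E.arc_inter_arc _ hw _ hw' he x
            ⟨tail_sub u w hw hxu, tail_sub v w' hw' hxv⟩
          exact huv ((tail_point u w y hw hxu).symm.trans (tail_point v w' y hw' hxv))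
  have mid_star : ∀ u v w, G.Adj u v → u < v → w ≠ u → w ≠ v → Disjoint (mid u v) (star w) := by
    intro u v w huv _ hwu hwv
    rw [Set.disjoint_left]
    intro x hx hxw
    rw [mem_star] at hxw
    rcases hxw with rfl | ⟨y, hy, hxw⟩
    · exact mid_point u v w huv hx
    · have he : s(u, v) ≠ s(w, y) := by
        rw [Ne, Sym2.eq_iff]
        rintro (h | h)
        · exact hwu h.1.symm
        · exact hwv h.2.symm
      obtain ⟨z, -, -, rfl⟩ := E.arc_inter_arc _ huv _ hy he x
        ⟨mid_sub u v huv hx, tail_sub w y hy hxw⟩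
      exact mid_point u v z huv hx
  have mid_mid : ∀ u v x y, G.Adj u v → u < v → G.Adj x y → x < y → (u ≠ x ∨ v ≠ y) →
      Disjoint (mid u v) (mid x y) := by
    intro u v x y huv huv' hxy hxy' hne
    rw [Set.disjoint_left]
    intro p hp hp'
    have he : s(u, v) ≠ s(x, y) := by
      rw [Ne, Sym2.eq_iff]
      rintro (⟨rfl, rfl⟩ | ⟨rfl, rfl⟩)
      · simp at hne
      · exact huv'.not_gt hxy'
    obtain ⟨z, -, -, rfl⟩ := E.arc_inter_arc _ huv _ hxy he p
      ⟨mid_sub u v huv hp, mid_sub x y hxy hp'⟩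
    exact mid_point u v z huv hp
  have hev : ∀ᶠ K : ℝ in Filter.atTop,
      (∀ u v, u ≠ v → Disjoint (gridHull K (star u)) (gridHull K (star v))) ∧
      (∀ u v w, G.Adj u v → u < v → w ≠ u → w ≠ v →
        Disjoint (gridHull K (mid u v)) (gridHull K (star w))) ∧
      (∀ u v x y, G.Adj u v → u < v → G.Adj x y → x < y → (u ≠ x ∨ v ≠ y) →
        Disjoint (gridHull K (mid u v)) (gridHull K (mid x y))) := by
    simp only [Filter.eventually_and, Filter.eventually_all]
    exact ⟨fun u v huv => eventually_disjoint_gridHull (star_compact u) (star_compact v)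
        (star_star u v huv),
      fun u v w huv h hwu hwv => eventually_disjoint_gridHull (mid_compact u v huv)
        (star_compact w) (mid_star u v w huv h hwu hwv),
      fun u v x y huv h hxy h' hne => eventually_disjoint_gridHull (mid_compact u v huv)
        (mid_compact x y hxy) (mid_mid u v x y huv h hxy h' hne)⟩
  obtain ⟨K, hss, hms, hmm⟩ := hev.exists
  have meet : ∀ {X Y : Set (EuclideanSpace ℝ (Fin 2))} {x}, x ∈ X → x ∈ Y →
      (gridHull K X ∩ gridHull K Y).Nonempty := by
    intro X Y x hx hy
    obtain ⟨p, hp⟩ := gridHull_nonempty K (Set.singleton_nonempty x)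
    exact ⟨p, gridHull_mono K (Set.singleton_subset_iff.2 hx) hp,
      gridHull_mono K (Set.singleton_subset_iff.2 hy) hp⟩
  refine SimpleGraph.hasDual_of_grid_sets (fun u => gridHull K (star u))
    (fun u v => gridHull K (mid u v)) (fun u => gridHull_finite K (star_compact u))
    (fun u v h _ => gridHull_finite K (mid_compact u v h))
    (fun u => gridHull_nonempty K ⟨E.point u, (mem_star u _).2 (Or.inl rfl)⟩)
    (fun u p hp q hq => gridHull_connected K (star_conn u) hp hq)
    (fun u v h _ p hp q hq => gridHull_connected K (mid_conn u v h) hp hq) hss hms hmm ?_ ?_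
  · intro u v huv hlt
    refine meet (x := c u v (1 / 3)) (tail_sub_star u v huv ?_) ⟨1 / 3, by norm_num, rfl⟩
    simp only [tail, hlt, if_true]
    exact ⟨1 / 3, by norm_num, rfl⟩
  · intro u v huv hlt
    refine meet (x := c u v (2 / 3)) (tail_sub_star v u huv.symm ?_) ⟨2 / 3, by norm_num, rfl⟩
    simp only [tail, hlt.not_gt, if_false]
    exact ⟨2 / 3, by norm_num, rfl⟩

lemma IsPlanarGraph.mono {V : Type*} {G H : SimpleGraph V} (h : IsPlanarGraph G) (hle : H ≤ G) :
    IsPlanarGraph H := by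
  obtain ⟨E⟩ := h
  have hsub : H.edgeSet ⊆ G.edgeSet := SimpleGraph.edgeSet_mono hle
  exact ⟨⟨E.point, E.arc, E.point_injective, fun u v huv => E.isPlaneArc u v (hle huv),
    fun e he => E.mem_of_point_mem_arc e (hsub he),
    fun e he f hf => E.arc_inter_arc e (hsub he) f (hsub hf)⟩⟩

lemma IsPlanarGraph.hasDual {V : Type} [Fintype V] [LinearOrder V] {G : SimpleGraph V}
    (h : IsPlanarGraph G) : G.HasDual := h.elim fun E => E.hasDual

/-! ### Copies of cycles and the upper bound. -/

namespace SimpleGraph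

lemma noSquare_of_free {V : Type*} {G : SimpleGraph V} (h : (cycleGraph 4).Free G) :
    G.NoSquare := by
  intro a b c d hac hbd hab hbc hcd hda
  apply h
  refine ⟨⟨⟨![a, b, c, d], ?_⟩, ?_⟩⟩
  · intro i j hij
    rw [cycleGraph_adj] at hij
    fin_cases i <;> fin_cases j <;>
      first | exact (by revert hij; decide : False).elim | skip
    all_goals simp [hab, hbc, hcd, hda, hab.symm, hbc.symm, hcd.symm, hda.symm]
  · intro i j hij
    have := hab.ne; have := hbc.ne; have := hcd.ne; have := hda.ne
    fin_cases i <;> fin_cases j <;> simp_all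

lemma NoSquare.free {V : Type*} {G : SimpleGraph V} (h : G.NoSquare) : (cycleGraph 4).Free G := by
  rintro ⟨f⟩
  have hadj : ∀ i j : Fin 4, (cycleGraph 4).Adj i j → G.Adj (f i) (f j) := fun i j => f.toHom.map_adj
  refine h (f 0) (f 1) (f 2) (f 3) (fun h => ?_) (fun h => ?_) (hadj _ _ ?_) (hadj _ _ ?_)
    (hadj _ _ ?_) (hadj _ _ ?_)
  · exact absurd (f.injective h) (by decide)
  · exact absurd (f.injective h) (by decide)
  all_goals decide

lemma IsPentagon.of_copy {V : Type*} {G : SimpleGraph V} (f : Copy (cycleGraph 5) G) :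
    G.IsPentagon f :=
  ⟨f.injective, fun i => f.toHom.map_adj
    ((by decide : ∀ i : Fin 5, (cycleGraph 5).Adj i (i + 1)) i)⟩

/-- A pentagon as a copy of the `5`-cycle. -/
def IsPentagon.toCopy {V : Type*} {G : SimpleGraph V} {f : Fin 5 → V} (h : G.IsPentagon f) :
    Copy (cycleGraph 5) G where
  toHom := ⟨f, fun {i j} hij => by
    have : j = i + 1 ∨ j = i - 1 :=
      (by decide : ∀ i j : Fin 5, (cycleGraph 5).Adj i j → j = i + 1 ∨ j = i - 1) i j hij
    rcases this with rfl | rfl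
    · exact h.2 i
    · exact h.adj_sub i⟩
  injective' := h.1

/-- In the absence of `4`-cycles, `5`-cycles are determined by their vertex sets. -/
lemma copyCount_eq_card_pentagons {V : Type*} [Fintype V] {G : SimpleGraph V} (h4 : G.NoSquare) :
    G.copyCount (cycleGraph 5) = G.pentagons.card := by
  classical
  rw [copyCount_eq_card_image_copyToSubgraph]
  refine Finset.card_bij (fun H _ => H.verts.toFinset) ?_ ?_ ?_
  · intro H hH
    obtain ⟨f, -, rfl⟩ := Finset.mem_image.1 hH
    rw [mem_pentagons]
    refine ⟨f, IsPentagon.of_copy f, ?_⟩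
    ext x; simp [Copy.toSubgraph]
  · intro H hH H' hH' heq
    obtain ⟨f, -, rfl⟩ := Finset.mem_image.1 hH
    obtain ⟨g, -, rfl⟩ := Finset.mem_image.1 hH'
    -- A copy is the induced subgraph on its vertices, so the vertex set determines it.
    have key : ∀ f : Copy (cycleGraph 5) G, ∀ u v, f.toSubgraph.Adj u v ↔
        u ∈ f.toSubgraph.verts ∧ v ∈ f.toSubgraph.verts ∧ G.Adj u v := by
      intro f u v
      constructor
      · intro h
        exact ⟨f.toSubgraph.edge_vert h, f.toSubgraph.edge_vert h.symm, h.adj_sub⟩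
      · rintro ⟨hu, hv, huv⟩
        have hu : ∃ i, f i = u := by simpa [Copy.toSubgraph] using hu
        have hv : ∃ i, f i = v := by simpa [Copy.toSubgraph] using hv
        obtain ⟨i, rfl⟩ := hu
        obtain ⟨j, rfl⟩ := hv
        have hij := ((IsPentagon.of_copy f).adj_iff h4 i j).1 huv
        have hadj : (cycleGraph 5).Adj i j :=
          (by decide : ∀ i j : Fin 5, j = i + 1 ∨ j = i - 1 → (cycleGraph 5).Adj i j) i j hij
        simp only [Copy.toSubgraph, Subgraph.map_adj, Relation.Map]
        exact ⟨i, j, by simpa using hadj, rfl, rfl⟩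
    have hverts : f.toSubgraph.verts = g.toSubgraph.verts := by
      have := congrArg (fun s : Finset V => (s : Set V)) heq
      simpa using this
    refine Subgraph.ext hverts ?_
    ext u v
    rw [key, key, hverts]
  · intro U hU
    obtain ⟨f, hf, rfl⟩ := mem_pentagons.1 hU
    refine ⟨hf.toCopy.toSubgraph, Finset.mem_image_of_mem _ (Finset.mem_univ _), ?_⟩
    ext x
    rw [Set.mem_toFinset, Finset.mem_image]
    exact ⟨fun ⟨i, _, h⟩ => ⟨i, Finset.mem_univ _, h⟩, fun ⟨i, _, h⟩ => ⟨i, trivial, h⟩⟩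

/-- A planar graph on `n` vertices without `4`-cycles has at most `n - 4` copies of the
`5`-cycle. -/
theorem copyCount_cycleGraph_five_le {n : ℕ} {G : SimpleGraph (Fin n)} (hG : IsPlanarGraph G)
    (h4 : G.NoSquare) : G.copyCount (cycleGraph 5) ≤ n - 4 := by
  rw [copyCount_eq_card_pentagons h4]
  have := card_pentagons_le (fun H hH => (hG.mono hH).hasDual) h4
    (S := Finset.univ) (fun _ _ _ => Finset.mem_univ _)
  simpa using this

end SimpleGraph

/-! ### The extremal construction. -/

lemma isPlaneArc_segment {p q : EuclideanSpace ℝ (Fin 2)} (h : p ≠ q) :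
    IsPlaneArc p q (segment ℝ p q) := by
  refine ⟨⟨⟨fun t => AffineMap.lineMap p q (t : ℝ), by fun_prop⟩, by simp, by simp⟩, ?_, ?_⟩
  · intro s t hst
    exact Subtype.ext (AffineMap.lineMap_injective ℝ h hst)
  · rw [segment_eq_image_lineMap]
    ext x
    constructor
    · rintro ⟨t, rfl⟩; exact ⟨t, t.2, rfl⟩
    · rintro ⟨t, ht, rfl⟩; exact ⟨⟨t, ht⟩, rfl⟩

/-- The vertices of the infinite ladder: two poles `u` and `v`, a common neighbour `w` of the poles,
paths `u, a i, b i, v`, and a vertex `x` between the first two of these paths. -/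
inductive LadderVertex
  | u | v | w | x
  | a (i : ℕ)
  | b (i : ℕ)
  deriving DecidableEq

/-- The edges of the infinite ladder. -/
inductive LadderEdge
  | uw | vw
  | ua (i : ℕ) | vb (i : ℕ) | ab (i : ℕ) | aa (k : ℕ) | bb (k : ℕ)
  | ax | xb

namespace LadderEdge

open LadderVertex

/-- The first end of an edge. -/
def src : LadderEdge → LadderVertex
  | uw => u | vw => v | ua _ => u | vb _ => v | ab i => a i
  | aa k => a (2 * k + 1) | bb k => b (2 * k + 2) | ax => a 0 | xb => x

/-- The second end of an edge. -/
def tgt : LadderEdge → LadderVertex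
  | uw => w | vw => w | ua i => a i | vb i => b i | ab i => b i
  | aa k => a (2 * k + 2) | bb k => b (2 * k + 3) | ax => x | xb => b 1

/-- The points of the segment representing an edge. -/
def Region : LadderEdge → ℝ → ℝ → Prop
  | uw, X, Y => -1 ≤ X ∧ X ≤ 0 ∧ Y = 2 + 2 * X
  | vw, X, Y => -1 ≤ X ∧ X ≤ 0 ∧ Y = -2 - 2 * X
  | ua i, X, Y => 1 ≤ Y ∧ Y ≤ 2 ∧ X = (i + 1) * (2 - Y)
  | vb i, X, Y => -2 ≤ Y ∧ Y ≤ -1 ∧ X = (i + 1) * (2 + Y)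
  | ab i, X, Y => -1 ≤ Y ∧ Y ≤ 1 ∧ X = i + 1
  | aa k, X, Y => Y = 1 ∧ 2 * k + 2 ≤ X ∧ X ≤ 2 * k + 3
  | bb k, X, Y => Y = -1 ∧ 2 * k + 3 ≤ X ∧ X ≤ 2 * k + 4
  | ax, X, Y => 1 ≤ X ∧ X ≤ 3 / 2 ∧ Y = 3 - 2 * X
  | xb, X, Y => 3 / 2 ≤ X ∧ X ≤ 2 ∧ Y = 3 - 2 * X

/-- The kinds of edges, numbered. -/
def kind : LadderEdge → ℕ
  | uw => 0 | vw => 1 | ua _ => 2 | vb _ => 3 | ab _ => 4 | aa _ => 5 | bb _ => 6 | ax => 7 | xb => 8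

end LadderEdge

namespace LadderVertex

/-- The horizontal coordinate of a vertex. -/
noncomputable def posX : LadderVertex → ℝ
  | u => 0 | v => 0 | w => -1 | x => 3 / 2 | a i => i + 1 | b i => i + 1

/-- The vertical coordinate of a vertex. -/
noncomputable def posY : LadderVertex → ℝ
  | u => 2 | v => -2 | w => 0 | x => 0 | a _ => 1 | b _ => -1

lemma ext_pos {p q : LadderVertex} (hX : p.posX = q.posX) (hY : p.posY = q.posY) : p = q := by
  cases p <;> cases q <;> simp only [posX, posY] at hX hY <;>
    first | rfl | (exfalso; linarith) | skip
  all_goals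
    have hX := add_right_cancel hX
    have hX := Nat.cast_injective hX
    rw [hX]

end LadderVertex

namespace LadderEdge

open LadderVertex

lemma region_src (e : LadderEdge) : e.Region e.src.posX e.src.posY := by
  cases e <;> simp only [Region, src, posX, posY] <;> push_cast <;> norm_num <;>
    constructor <;> linarith

lemma region_tgt (e : LadderEdge) : e.Region e.tgt.posX e.tgt.posY := by
  cases e <;> simp only [Region, tgt, posX, posY] <;> push_cast <;> norm_num <;> linarith

lemma region_convex (e : LadderEdge) {X Y t : ℝ} (h0 : 0 ≤ t) (h1 : t ≤ 1)
    (hX : X = e.src.posX + t * (e.tgt.posX - e.src.posX))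
    (hY : Y = e.src.posY + t * (e.tgt.posY - e.src.posY)) : e.Region X Y := by
  subst hX hY
  cases e <;> simp only [Region, src, tgt, posX, posY] <;> push_cast <;>
    refine ⟨?_, ?_, ?_⟩ <;> linarith

/-- Segments of distinct edges meet only in common ends. -/
lemma region_inter {e f : LadderEdge} (hne : e ≠ f) {X Y : ℝ} (he : e.Region X Y)
    (hf : f.Region X Y) : ∃ p, (p = e.src ∨ p = e.tgt) ∧ (p = f.src ∨ p = f.tgt) ∧
      X = p.posX ∧ Y = p.posY := by
  wlog h : e.kind ≤ f.kind generalizing e f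
  · obtain ⟨p, h1, h2, h3⟩ := this hne.symm hf he (le_of_not_ge h)
    exact ⟨p, h2, h1, h3⟩
  have nat_of : ∀ {i j : ℕ}, (i : ℝ) < j + 1 → (j : ℝ) < i + 1 → i = j := by
    intro i j h1 h2
    have h1 : i < j + 1 := by exact_mod_cast h1
    have h2 : j < i + 1 := by exact_mod_cast h2
    omega
  have nat_nonneg : ∀ i : ℕ, (0 : ℝ) ≤ i := fun i => Nat.cast_nonneg i
  cases e <;> cases f <;>
    first
    | exact absurd h (by decide)
    | (simp [kind] at h; done)
    | exact absurd rfl hne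
    | skip
  all_goals simp only [Region] at he hf
  -- Kinds of edges that never meet are refuted by their linear bounds; the cases below are the
  -- others.
  all_goals try (exfalso; linarith [he.1, he.2.1, he.2.2, hf.1, hf.2.1, hf.2.2])
  all_goals obtain ⟨he1, he2, he3⟩ := he
  all_goals obtain ⟨hf1, hf2, hf3⟩ := hf
  case uw.vw =>
    have hX : X = -1 := by linarith
    refine ⟨w, Or.inr rfl, Or.inr rfl, hX, ?_⟩
    simp only [posY]; linarith
  case uw.ua i =>
    have hX : X = 0 := le_antisymm he2 (by rw [hf3]; nlinarith [nat_nonneg i])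
    refine ⟨u, Or.inl rfl, Or.inl rfl, hX, ?_⟩
    simp only [posY]; linarith
  case vw.vb i =>
    have hX : X = 0 := le_antisymm he2 (by rw [hf3]; nlinarith [nat_nonneg i])
    refine ⟨v, Or.inl rfl, Or.inl rfl, hX, ?_⟩
    simp only [posY]; linarith
  case ua.ua i j =>
    have hij : (i : ℝ) ≠ j := fun h => hne (by rw [Nat.cast_injective h])
    have hY : (i - j : ℝ) * (2 - Y) = 0 := by linarith
    have hY : 2 - Y = 0 := (mul_eq_zero.1 hY).resolve_left (sub_ne_zero.2 hij)
    refine ⟨u, Or.inl rfl, Or.inl rfl, ?_, ?_⟩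
    · rw [he3, hY, mul_zero]; rfl
    · simp only [posY]; linarith
  case vb.vb i j =>
    have hij : (i : ℝ) ≠ j := fun h => hne (by rw [Nat.cast_injective h])
    have hY : (i - j : ℝ) * (2 + Y) = 0 := by linarith
    have hY : 2 + Y = 0 := (mul_eq_zero.1 hY).resolve_left (sub_ne_zero.2 hij)
    refine ⟨v, Or.inl rfl, Or.inl rfl, ?_, ?_⟩
    · rw [he3, hY, mul_zero]; rfl
    · simp only [posY]; linarith
  case ua.ab i j =>
    have hY : Y = 1 := le_antisymm hf2 he1
    subst hY
    obtain rfl : i = j := nat_of (by linarith) (by linarith)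
    exact ⟨a i, Or.inr rfl, Or.inl rfl, hf3, rfl⟩
  case vb.ab i j =>
    have hY : Y = -1 := le_antisymm he2 hf1
    subst hY
    obtain rfl : i = j := nat_of (by linarith) (by linarith)
    exact ⟨b i, Or.inr rfl, Or.inr rfl, hf3, rfl⟩
  case ua.aa i k =>
    subst hf1
    have hX : X = i + 1 := by linarith
    have h1 : 2 * k + 2 ≤ i + 1 := by exact_mod_cast hX ▸ hf2
    have h2 : i + 1 ≤ 2 * k + 3 := by exact_mod_cast hX ▸ hf3
    refine ⟨a i, Or.inr rfl, ?_, hX, rfl⟩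
    simp only [src, tgt, a.injEq]; omega
  case vb.bb i k =>
    subst hf1
    have hX : X = i + 1 := by linarith
    have h1 : 2 * k + 3 ≤ i + 1 := by exact_mod_cast hX ▸ hf2
    have h2 : i + 1 ≤ 2 * k + 4 := by exact_mod_cast hX ▸ hf3
    refine ⟨b i, Or.inr rfl, ?_, hX, rfl⟩
    simp only [src, tgt, b.injEq]; omega
  case ua.ax i =>
    have hX : X = 1 := by linarith
    have hY : Y = 1 := by linarith
    subst hX hY
    obtain rfl : i = 0 := nat_of (by push_cast; linarith) (by push_cast; linarith)
    exact ⟨a 0, Or.inr rfl, Or.inl rfl, by simp [posX], rfl⟩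
  case vb.xb i =>
    have hX : X = 2 := by linarith
    have hY : Y = -1 := by linarith
    subst hX hY
    obtain rfl : i = 1 := nat_of (by push_cast; linarith) (by push_cast; linarith)
    exact ⟨b 1, Or.inr rfl, Or.inr rfl, by norm_num [posX], rfl⟩
  case ab.ab i j =>
    exact absurd (by rw [nat_of (i := i) (j := j) (by linarith) (by linarith)]) hne
  case ab.aa i k =>
    have h1 : 2 * k + 2 ≤ i + 1 := by exact_mod_cast he3 ▸ hf2
    have h2 : i + 1 ≤ 2 * k + 3 := by exact_mod_cast he3 ▸ hf3
    refine ⟨a i, Or.inl rfl, ?_, he3, hf1⟩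
    simp only [src, tgt, a.injEq]; omega
  case ab.bb i k =>
    have h1 : 2 * k + 3 ≤ i + 1 := by exact_mod_cast he3 ▸ hf2
    have h2 : i + 1 ≤ 2 * k + 4 := by exact_mod_cast he3 ▸ hf3
    refine ⟨b i, Or.inr rfl, ?_, he3, hf1⟩
    simp only [src, tgt, b.injEq]; omega
  case ab.ax i =>
    obtain rfl : i = 0 := nat_of (by push_cast; linarith) (by push_cast; linarith [nat_nonneg i])
    have hX : X = 1 := by rw [he3]; simp
    refine ⟨a 0, Or.inl rfl, Or.inl rfl, he3, ?_⟩
    simp only [posY]; linarith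
  case ab.xb i =>
    obtain rfl : i = 1 := nat_of (by push_cast; linarith) (by push_cast; linarith)
    have hX : X = 2 := by rw [he3]; norm_num
    refine ⟨b 1, Or.inr rfl, Or.inr rfl, he3, ?_⟩
    simp only [posY]; linarith
  case aa.aa k k' =>
    exact absurd (by rw [nat_of (i := k) (j := k') (by linarith) (by linarith)]) hne
  case bb.bb k k' =>
    exact absurd (by rw [nat_of (i := k) (j := k') (by linarith) (by linarith)]) hne
  case ax.xb =>
    have hX : X = 3 / 2 := by linarith
    refine ⟨x, Or.inr rfl, Or.inl rfl, hX, ?_⟩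
    simp only [posY]; linarith

end LadderEdge

open LadderEdge LadderVertex

/-- The infinite ladder. -/
def ladder : SimpleGraph LadderVertex where
  Adj p q := ∃ e : LadderEdge, (e.src = p ∧ e.tgt = q) ∨ (e.src = q ∧ e.tgt = p)
  symm := ⟨fun _ _ ⟨e, h⟩ => ⟨e, h.symm⟩⟩
  loopless := ⟨fun p ⟨e, h⟩ => by
    have h : e.src = e.tgt := by rcases h with ⟨h1, h2⟩ | ⟨h1, h2⟩ <;> rw [h1, h2]
    cases e <;> simp [src, tgt] at h⟩

/-- The position of a vertex in the plane. -/
noncomputable def LadderVertex.pos (p : LadderVertex) : EuclideanSpace ℝ (Fin 2) :=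
  !₂[p.posX, p.posY]

lemma LadderVertex.pos_injective : Function.Injective LadderVertex.pos := by
  intro p q h
  exact ext_pos (by simpa [pos] using congrArg (fun z => z 0) h)
    (by simpa [pos] using congrArg (fun z => z 1) h)

lemma LadderEdge.region_of_mem_segment (e : LadderEdge) {z : EuclideanSpace ℝ (Fin 2)}
    (hz : z ∈ segment ℝ e.src.pos e.tgt.pos) : e.Region (z 0) (z 1) := by
  rw [segment_eq_image_lineMap] at hz
  obtain ⟨t, ht, rfl⟩ := hz
  refine e.region_convex ht.1 ht.2 ?_ ?_ <;> simp [AffineMap.lineMap_apply, pos] <;> ring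

/-- The straight line drawing of the ladder. -/
noncomputable def ladderEmbedding : PlaneEmbedding ladder where
  point := LadderVertex.pos
  arc := Sym2.lift ⟨fun p q => segment ℝ p.pos q.pos, fun _ _ => segment_symm _ _ _⟩
  point_injective := LadderVertex.pos_injective
  isPlaneArc p q h := isPlaneArc_segment (LadderVertex.pos_injective.ne h.ne)
  mem_of_point_mem_arc := by
    intro e' he' p hp
    induction e' with
    | _ q r =>
    obtain ⟨e, he⟩ : ladder.Adj q r := he'
    have hreg : e.Region p.posX p.posY := by
      have hp : p.pos ∈ segment ℝ q.pos r.pos := hp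
      have : p.pos ∈ segment ℝ e.src.pos e.tgt.pos := by
        rcases he with ⟨rfl, rfl⟩ | ⟨rfl, rfl⟩
        · exact hp
        · rwa [segment_symm]
      simpa [pos] using e.region_of_mem_segment this
    -- Every vertex is an end of some edge, so a vertex lying on `e` is a meeting point of two edges
    -- unless `f` is `e` itself.
    obtain ⟨f, hf⟩ : ∃ f : LadderEdge, f.Region p.posX p.posY ∧ (f.src = p ∨ f.tgt = p) := by
      cases p
      · exact ⟨uw, region_src uw, Or.inl rfl⟩
      · exact ⟨vw, region_src vw, Or.inl rfl⟩
      · exact ⟨vw, region_tgt vw, Or.inr rfl⟩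
      · exact ⟨ax, region_tgt ax, Or.inr rfl⟩
      · rename_i i; exact ⟨ua i, region_tgt (ua i), Or.inr rfl⟩
      · rename_i i; exact ⟨vb i, region_tgt (vb i), Or.inr rfl⟩
    have hpe : p = e.src ∨ p = e.tgt := by
      by_cases hef : e = f
      · subst hef; exact hf.2.imp Eq.symm Eq.symm
      · obtain ⟨p', h1, -, hX, hY⟩ := region_inter hef hreg hf.1
        rw [ext_pos hX hY]; exact h1
    rw [Sym2.mem_iff]
    rcases he with ⟨rfl, rfl⟩ | ⟨rfl, rfl⟩
    · exact hpe
    · exact hpe.symm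
  arc_inter_arc := by
    intro e' he' f' hf' hne z hz
    induction e' with
    | _ q r =>
    induction f' with
    | _ q' r' =>
    obtain ⟨e, he⟩ : ladder.Adj q r := he'
    obtain ⟨f, hf⟩ : ladder.Adj q' r' := hf'
    have heq : s(q, r) = s(e.src, e.tgt) := by
      rcases he with ⟨rfl, rfl⟩ | ⟨rfl, rfl⟩
      · rfl
      · exact Sym2.eq_swap
    have hfq : s(q', r') = s(f.src, f.tgt) := by
      rcases hf with ⟨rfl, rfl⟩ | ⟨rfl, rfl⟩
      · rfl
      · exact Sym2.eq_swap
    rw [heq, hfq] at hz hne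
    obtain ⟨p, h1, h2, hX, hY⟩ := region_inter (fun h => hne (by rw [h]))
      (e.region_of_mem_segment hz.1) (f.region_of_mem_segment hz.2)
    refine ⟨p, by rw [heq]; exact Sym2.mem_iff.2 h1, by rw [hfq]; exact Sym2.mem_iff.2 h2, ?_⟩
    ext i
    fin_cases i
    · simpa [pos] using hX
    · simpa [pos] using hY

lemma IsPlanarGraph.comap {V W : Type*} {G : SimpleGraph W} (h : IsPlanarGraph G) {f : V → W}
    (hf : Function.Injective f) : IsPlanarGraph (G.comap f) := by
  obtain ⟨E⟩ := h
  have hmap : ∀ e : Sym2 V, e ∈ (G.comap f).edgeSet → e.map f ∈ G.edgeSet := by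
    intro e he
    induction e with
    | _ p q => exact he
  have hmem : ∀ (e : Sym2 V) (p : V), f p ∈ e.map f → p ∈ e := by
    intro e p hp
    obtain ⟨q, hq, hqp⟩ := Sym2.mem_map.1 hp
    rwa [← hf hqp]
  refine ⟨⟨fun p => E.point (f p), fun e => E.arc (e.map f), E.point_injective.comp hf,
    fun p q hpq => E.isPlaneArc _ _ hpq, fun e he p hp => hmem e p
      (E.mem_of_point_mem_arc _ (hmap e he) _ hp), fun e he e' he' hne z hz => ?_⟩⟩
  obtain ⟨q, hq, hq', hz⟩ := E.arc_inter_arc _ (hmap e he) _ (hmap e' he')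
    (fun h => hne (Sym2.map.injective hf h)) z hz
  obtain ⟨p, hp, rfl⟩ := Sym2.mem_map.1 hq
  exact ⟨p, hp, hmem e' p hq', hz⟩


/-- A decidable description of adjacency in the ladder. -/
def LadderVertex.Near : LadderVertex → LadderVertex → Prop
  | u, w => True | w, u => True | v, w => True | w, v => True
  | u, a _ => True | a _, u => True | v, b _ => True | b _, v => True
  | a i, b j => i = j | b i, a j => i = j
  | a i, a j => (j = i + 1 ∧ i % 2 = 1) ∨ (i = j + 1 ∧ j % 2 = 1)
  | b i, b j => (j = i + 1 ∧ i % 2 = 0 ∧ i ≠ 0) ∨ (i = j + 1 ∧ j % 2 = 0 ∧ j ≠ 0)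
  | a i, x => i = 0 | x, a i => i = 0 | b i, x => i = 1 | x, b i => i = 1
  | _, _ => False

lemma ladder_adj_iff {p q : LadderVertex} : ladder.Adj p q ↔ p.Near q := by
  constructor
  · rintro ⟨e, ⟨rfl, rfl⟩ | ⟨rfl, rfl⟩⟩ <;> cases e <;> simp [Near, src, tgt]
  · intro h
    cases p <;> cases q <;> simp only [Near] at h
    case u.w => exact ⟨uw, Or.inl ⟨rfl, rfl⟩⟩
    case w.u => exact ⟨uw, Or.inr ⟨rfl, rfl⟩⟩
    case v.w => exact ⟨vw, Or.inl ⟨rfl, rfl⟩⟩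
    case w.v => exact ⟨vw, Or.inr ⟨rfl, rfl⟩⟩
    case u.a i => exact ⟨ua i, Or.inl ⟨rfl, rfl⟩⟩
    case a.u i => exact ⟨ua i, Or.inr ⟨rfl, rfl⟩⟩
    case v.b i => exact ⟨vb i, Or.inl ⟨rfl, rfl⟩⟩
    case b.v i => exact ⟨vb i, Or.inr ⟨rfl, rfl⟩⟩
    case a.b i j => subst h; exact ⟨ab i, Or.inl ⟨rfl, rfl⟩⟩
    case b.a i j => subst h; exact ⟨ab i, Or.inr ⟨rfl, rfl⟩⟩
    case x.a i => subst h; exact ⟨ax, Or.inr ⟨rfl, rfl⟩⟩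
    case a.x i => subst h; exact ⟨ax, Or.inl ⟨rfl, rfl⟩⟩
    case x.b i => subst h; exact ⟨xb, Or.inl ⟨rfl, rfl⟩⟩
    case b.x i => subst h; exact ⟨xb, Or.inr ⟨rfl, rfl⟩⟩
    case a.a i j =>
      rcases h with h | h
      · refine ⟨aa (i / 2), Or.inl ⟨?_, ?_⟩⟩ <;> simp only [src, tgt, a.injEq] <;> omega
      · refine ⟨aa (j / 2), Or.inr ⟨?_, ?_⟩⟩ <;> simp only [src, tgt, a.injEq] <;> omega
    case b.b i j =>
      rcases h with h | h
      · refine ⟨bb (i / 2 - 1), Or.inl ⟨?_, ?_⟩⟩ <;> simp only [src, tgt, b.injEq] <;> omega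
      · refine ⟨bb (j / 2 - 1), Or.inr ⟨?_, ?_⟩⟩ <;> simp only [src, tgt, b.injEq] <;> omega

/-- Rungs between consecutive paths alternate between the `a` side and the `b` side. Hence no two
paths are joined on both sides, and no three consecutive `a i` or `b i` form a path that a pole
would close to a `4`-cycle. -/
lemma ladder_noSquare : ladder.NoSquare := by
  intro p q r s hpr hqs hpq hqr hrs hsp
  rw [ladder_adj_iff] at hpq hqr hrs hsp
  cases p <;> cases q <;> simp only [Near] at hpq <;> cases r <;> simp only [Near] at hqr <;>
    cases s <;> simp only [Near] at hrs hsp <;>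
    simp only [ne_eq, not_true_eq_false, a.injEq, b.injEq] at hpr hqs <;> omega

namespace SimpleGraph

lemma isPentagon_of_adj {V : Type*} [DecidableEq V] {G : SimpleGraph V} {p q r s t : V}
    (hnd : [p, q, r, s, t].Nodup) (h1 : G.Adj p q) (h2 : G.Adj q r) (h3 : G.Adj r s)
    (h4 : G.Adj s t) (h5 : G.Adj t p) :
    ∃ f, G.IsPentagon f ∧ Finset.univ.image f = {p, q, r, s, t} := by
  refine ⟨![p, q, r, s, t], ⟨?_, fun i => ?_⟩, ?_⟩
  · have := List.nodup_iff_injective_get.1 hnd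
    intro i j hij
    apply this
    fin_cases i <;> fin_cases j <;> first | rfl | simpa using hij
  · fin_cases i <;> assumption
  · ext y
    simp [Fin.exists_fin_succ, eq_comm]

end SimpleGraph

/-- `P` is a set of pentagons of the ladder inside `S`. -/
def IsPentagonFamily (S : Finset LadderVertex) (P : Finset (Finset LadderVertex)) : Prop :=
  ∀ U ∈ P, U ⊆ S ∧ ∃ f, ladder.IsPentagon f ∧ Finset.univ.image f = U

lemma IsPentagonFamily.insert {S U : Finset LadderVertex} {P : Finset (Finset LadderVertex)}
    (h : IsPentagonFamily S P) (hU : U ⊆ S)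
    (hf : ∃ f, ladder.IsPentagon f ∧ Finset.univ.image f = U) :
    IsPentagonFamily S (insert U P) := by
  intro U' hU'
  rcases Finset.mem_insert.1 hU' with rfl | hU'
  · exact ⟨hU, hf⟩
  · exact h U' hU'

/-- Some `n` vertices of the ladder, with last path `u, a k, b k, v`, span `n - 4` pentagons. -/
def HasManyPentagons (n : ℕ) : Prop :=
  ∃ (S : Finset LadderVertex) (k : ℕ) (P : Finset (Finset LadderVertex)), S.card = n ∧
    P.card = n - 4 ∧ 1 ≤ k ∧ u ∈ S ∧ v ∈ S ∧ w ∈ S ∧ a k ∈ S ∧ b k ∈ S ∧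
    (∀ i, k < i → a i ∉ S ∧ b i ∉ S) ∧ IsPentagonFamily S P

/-- The path has index 1 because rungs only start there; index 0 is reserved for the graph with `x`.
-/
lemma hasManyPentagons_five : HasManyPentagons 5 := by
  refine ⟨{u, a 1, b 1, v, w}, 1, {{u, a 1, b 1, v, w}}, by decide, by decide, le_rfl, by decide,
    by decide, by decide, by decide, by decide, fun i hi => ?_, ?_⟩
  · simp; omega
  · refine IsPentagonFamily.insert (P := ∅) (by simp [IsPentagonFamily]) subset_rfl ?_
    refine SimpleGraph.isPentagon_of_adj (by decide) ?_ ?_ ?_ ?_ ?_ <;> simp [ladder_adj_iff, Near]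

/-- The path through `x` joins two opposite vertices of the hexagon formed by the paths 0 and 1, and
so splits it into two pentagons. -/
lemma hasManyPentagons_eight : HasManyPentagons 8 := by
  refine ⟨{u, v, w, x, a 0, b 0, a 1, b 1}, 1, {{u, a 1, b 1, v, w}, {u, a 0, b 0, v, w},
    {u, a 0, x, b 1, a 1}, {v, b 0, a 0, x, b 1}}, by decide, by decide, le_rfl, by decide,
    by decide, by decide, by decide, by decide, fun i hi => ?_, ?_⟩
  · simp; omega
  · refine .insert (.insert (.insert (.insert (P := ∅) (by simp [IsPentagonFamily]) ?_ ?_)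
      ?_ ?_) ?_ ?_) ?_ ?_
    all_goals first
      | decide
      | (refine SimpleGraph.isPentagon_of_adj (by decide) ?_ ?_ ?_ ?_ ?_ <;>
          simp [ladder_adj_iff, Near])

/-- The new path forms one pentagon with `w` and the poles and another with path `k`: the rung lies
on the `b` side for even `k` and on the `a` side for odd `k`, and the second pentagon closes through
the opposite pole. -/
lemma HasManyPentagons.add_two {n : ℕ} (hn : 4 ≤ n) (h : HasManyPentagons n) :
    HasManyPentagons (n + 2) := by
  obtain ⟨S, k, P, hS, hP, hk, hu, hv, hw, ha, hb, hnot, hfam⟩ := h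
  have ha' := (hnot (k + 1) (by omega)).1
  have hb' := (hnot (k + 1) (by omega)).2
  set S' : Finset LadderVertex := insert (a (k + 1)) (insert (b (k + 1)) S) with hS'
  have hsub : S ⊆ S' := fun p hp => by simp [S', hp]
  have haS' : a (k + 1) ∈ S' := by simp [S']
  have hbS' : b (k + 1) ∈ S' := by simp [S']
  obtain ⟨U, hUS, haU, hwU, hU⟩ : ∃ U ⊆ S', a (k + 1) ∈ U ∧ w ∉ U ∧
      ∃ f, ladder.IsPentagon f ∧ Finset.univ.image f = U := by
    rcases Nat.mod_two_eq_zero_or_one k with h | h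
    · refine ⟨{u, a k, b k, b (k + 1), a (k + 1)}, ?_, by simp, by simp, ?_⟩
      · simp [Finset.insert_subset_iff, hsub hu, hsub ha, hsub hb, haS', hbS']
      · refine SimpleGraph.isPentagon_of_adj (by simp) ?_ ?_ ?_ ?_ ?_ <;>
          simp [ladder_adj_iff, Near, h]
        omega
    · refine ⟨{v, b k, a k, a (k + 1), b (k + 1)}, ?_, by simp, by simp, ?_⟩
      · simp [Finset.insert_subset_iff, hsub hv, hsub ha, hsub hb, haS', hbS']
      · refine SimpleGraph.isPentagon_of_adj (by simp) ?_ ?_ ?_ ?_ ?_ <;>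
          simp [ladder_adj_iff, Near, h]
  have hnew : ∀ T ∈ P, a (k + 1) ∉ T := fun T hT haT => ha' ((hfam T hT).1 haT)
  have hfam' : IsPentagonFamily S' P := fun T hT => ⟨(hfam T hT).1.trans hsub, (hfam T hT).2⟩
  refine ⟨S', k + 1, insert {u, a (k + 1), b (k + 1), v, w} (insert U P), ?_, ?_, by omega, hsub hu,
    hsub hv, hsub hw, haS', hbS', fun i hi => ?_, (hfam'.insert hUS hU).insert ?_ ?_⟩
  · rw [hS', Finset.card_insert_of_notMem (by simp [ha']), Finset.card_insert_of_notMem hb', hS]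
  · rw [Finset.card_insert_of_notMem, Finset.card_insert_of_notMem, hP]
    · omega
    · exact fun h => hnew U h haU
    · rw [Finset.mem_insert, not_or]
      refine ⟨fun h => hwU (h ▸ by simp), fun h => hnew _ h (by simp)⟩
  · have := hnot i (by omega)
    simp [S', this]; omega
  · simp [Finset.insert_subset_iff, hsub hu, hsub hv, hsub hw, haS', hbS']
  · refine SimpleGraph.isPentagon_of_adj (by simp) ?_ ?_ ?_ ?_ ?_ <;> simp [ladder_adj_iff, Near]

/-- Steps of two reach the odd numbers from 5 and the even ones from 8; 6 is out of reach. -/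
lemma hasManyPentagons (n : ℕ) (hn : 5 ≤ n) (hn6 : n ≠ 6) : HasManyPentagons n := by
  induction n using Nat.strong_induction_on with
  | _ n ih =>
  by_cases h5 : n = 5
  · subst h5; exact hasManyPentagons_five
  by_cases h8 : n = 8
  · subst h8; exact hasManyPentagons_eight
  obtain ⟨m, rfl⟩ : ∃ m, n = m + 2 := ⟨n - 2, by omega⟩
  exact (ih m (by omega) (by omega) (by omega)).add_two (by omega)

lemma exists_isPentagonFamily (n : ℕ) (hn : 4 ≤ n) (hn6 : n ≠ 6) :
    ∃ S P, S.card = n ∧ P.card = n - 4 ∧ IsPentagonFamily S P := by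
  rcases hn.eq_or_lt with rfl | hn
  · exact ⟨{u, v, w, x}, ∅, by decide, rfl, by simp [IsPentagonFamily]⟩
  · obtain ⟨S, k, P, hS, hP, -, -, -, -, -, -, -, h⟩ := hasManyPentagons n hn hn6
    exact ⟨S, P, hS, hP, h⟩

/-- A lower bound is enough, since the general upper bound turns it into equality. -/
lemma exists_planar_noSquare_card_pentagons_ge (n : ℕ) (hn : 4 ≤ n) (hn6 : n ≠ 6) :
    ∃ G : SimpleGraph (Fin n), IsPlanarGraph G ∧ G.NoSquare ∧ n - 4 ≤ G.pentagons.card := by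
  classical
  obtain ⟨S, P, hS, hP, hfam⟩ := exists_isPentagonFamily n hn hn6
  let e : S ≃ Fin n := S.equivFinOfCardEq hS
  let φ : Fin n → LadderVertex := fun i => (e.symm i).1
  have hφ : Function.Injective φ := Subtype.val_injective.comp e.symm.injective
  refine ⟨ladder.comap φ, IsPlanarGraph.comap ⟨ladderEmbedding⟩ hφ, ?_, ?_⟩
  · intro p q r s hpr hqs h1 h2 h3 h4
    exact ladder_noSquare _ _ _ _ (hφ.ne hpr) (hφ.ne hqs) h1 h2 h3 h4
  · rw [← hP]
    refine (Finset.card_le_card (t := (ladder.comap φ).pentagons.image (Finset.image φ)) ?_).trans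
      Finset.card_image_le
    intro U hU
    obtain ⟨hUS, f, hf, rfl⟩ := hfam U hU
    have hfS : ∀ i, f i ∈ S := fun i => hUS (by simp)
    have hφf : ∀ i, φ (e ⟨f i, hfS i⟩) = f i := fun i => by simp [φ]
    have hpent : (ladder.comap φ).IsPentagon (fun i => e ⟨f i, hfS i⟩) := by
      refine ⟨fun i j hij => hf.1 ?_, fun i => ?_⟩
      · rw [← hφf i, ← hφf j]; exact congrArg φ hij
      · rw [SimpleGraph.comap_adj, hφf, hφf]; exact hf.2 i
    refine Finset.mem_image.2 ⟨_, SimpleGraph.mem_pentagons.2 ⟨_, hpent, rfl⟩, ?_⟩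
    ext y
    simp [hφf]

theorem theorem5 (n : ℕ) (hn : 4 ≤ n) (hn6 : n ≠ 6) :
    IsGreatest
      (planarCopyCounts n (SimpleGraph.cycleGraph 5) (SimpleGraph.cycleGraph 4)) (n - 4) := by
  constructor
  · obtain ⟨G, hG, h4, hcard⟩ := exists_planar_noSquare_card_pentagons_ge n hn hn6
    refine ⟨G, hG, h4.free, le_antisymm (SimpleGraph.copyCount_cycleGraph_five_le hG h4) ?_⟩
    rwa [SimpleGraph.copyCount_eq_card_pentagons h4]
  · rintro k ⟨G, hG, hfree, rfl⟩
    exact SimpleGraph.copyCount_cycleGraph_five_le hG (SimpleGraph.noSquare_of_free hfree)
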